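/- Let $\sigma\in L_2(0,\pi)$ be complex-valued and let $p_1,p_2,r_1,r_2$ be complex polynomials such that $p_1,p_2$ are relatively prime and $r_1,r_2$ are relatively prime. Let $L=L(\sigma,p_1,p_2,r_1,r_2)$ be the boundary value problem $$-(y^{[1]})'-\sigma y^{[1]}-\sigma^2y=\lambda y\ \text{ on }(0,\pi),\qquad y^{[1]}:=y'-\sigma y,$$ $$p_1(\lambda)y^{[1]}(0)-p_2(\lambda)y(0)=0,\qquad r_1(\lambda)y^{[1]}(\pi)+r_2(\lambda)y(\pi)=0,$$ where solutions $y$ and their quasi-derivatives $y^{[1]}$ are absolutely continuous on $[0,\pi]$ and the equations hold a.e. Let $\psi(x,\lambda)$ be the solution of the equation with $\psi(\pi,\lambda)=r_1(\lambda)$, $\psi^{[1]}(\pi,\lambda)=-r_2(\lambda)$. The Weyl function of $L$ is the meromorphic function $$M^1(\lambda):=-\frac{\psi(0,\lambda)}{p_1(\lambda)\psi^{[1]}(0,\lambda)-p_2(\lambda)\psi(0,\lambda)}.$$ The pair $(r_1,r_2)$ is called normalized if either $\deg r_1\ge\deg r_2$ and $r_1$ has leading coefficient $1$, or $\deg r_1<\deg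 r_2$ and $r_2$ has leading coefficient $1$ (with $\deg 0=-\infty$). Let $L=L(\sigma,p_1,p_2,r_1,r_2)$ and $\tilde L=L(\tilde\sigma,\tilde p_1,\tilde p_2,\tilde r_1,\tilde r_2)$ be two such problems with normalized pairs $(r_1,r_2)$ and $(\tilde r_1,\tilde r_2)$, and let $p_1\not\equiv0$. If $p_j\equiv\tilde p_j$, $j=1,2$, and $M^1(\lambda)=\tilde M^1(\lambda)$ for all $\lambda$ at which neither of the two denominators vanishes, then $\sigma=\tilde\sigma$ a.e. on $(0,\pi)$ and $r_j\equiv\tilde r_j$, $j=1,2$. -/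

import Mathlib

open Real Set Filter Topology MeasureTheory Polynomial

/-- `y` solves `ℓ y = lam y` on `(0, π)` with `ℓ y = -(y₁)' - σ y₁ - σ² y`, where `y₁` is the
quasi-derivative `y' - σ y`; both `y` and `y₁` are absolutely continuous on `[0, π]`. -/
structure IsSLSolution (σ : ℝ → ℂ) (lam : ℂ) (y y₁ : ℝ → ℂ) : Prop where
  ac : AbsolutelyContinuousOnInterval y 0 π
  ac_quasi : AbsolutelyContinuousOnInterval y₁ 0 π
  quasi : ∀ᵐ x ∂volume.restrict (Ioo 0 π), ∃ y' : ℂ, HasDerivAt y y' x ∧ y₁ x = y' - σ x * y x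
  eqn : ∀ᵐ x ∂volume.restrict (Ioo 0 π), ∃ d : ℂ, HasDerivAt y₁ d x ∧
    -d - σ x * y₁ x - σ x ^ 2 * y x = lam * y x

/-- For `g x = ∫_x^π a`, one has `∫_x^π a gⁿ = gⁿ⁺¹ / (n + 1)`. -/
theorem integral_mul_primitive_pow {a : ℝ → ℝ} (ha : IntervalIntegrable a volume 0 π) (n : ℕ)
    {x : ℝ} (hx : x ∈ Icc 0 π) :
    ∫ t in x..π, a t * (∫ s in t..π, a s) ^ n = (∫ s in x..π, a s) ^ (n + 1) / (n + 1) := by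
  have hsub : uIcc x π ⊆ uIcc 0 π := by
    rw [uIcc_of_le hx.2, uIcc_of_le pi_pos.le]; exact Icc_subset_Icc hx.1 le_rfl
  have hax : IntervalIntegrable a volume x π := ha.mono_set hsub
  have hac : AbsolutelyContinuousOnInterval (fun t => ∫ s in t..π, a s) x π := by
    have := (hax.absolutelyContinuousOnInterval_intervalIntegral (c := π) (by simp)).neg
    refine (congrArg (fun f => AbsolutelyContinuousOnInterval f x π) ?_).mp this
    funext t
    simp [intervalIntegral.integral_symm π t]
  have hpow : ∀ m : ℕ, AbsolutelyContinuousOnInterval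
      (fun t => (∫ s in t..π, a s) ^ (m + 1)) x π := by
    intro m
    induction m with
    | zero => simpa using hac
    | succ k ih =>
      have := ih.fun_mul hac
      simpa only [pow_succ] using this
  have hF := (hpow n).integral_deriv_eq_sub
  have hcongr : ∫ t in x..π, deriv (fun t => (∫ s in t..π, a s) ^ (n + 1)) t
      = ∫ t in x..π, (-((n : ℝ) + 1)) * (a t * (∫ s in t..π, a s) ^ n) := by
    apply intervalIntegral.integral_congr_ae
    filter_upwards [hax.ae_hasDerivAt_integral] with t ht htm
    have h1 := (ht (uIoc_subset_uIcc htm) π (by simp)).neg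
    have h2 : HasDerivAt (fun t => ∫ s in t..π, a s) (-a t) t := by
      refine h1.congr_of_eventuallyEq (Eventually.of_forall fun u => ?_)
      simp [intervalIntegral.integral_symm π u]
    rw [(h2.fun_pow (n + 1)).deriv]
    push_cast
    simp
    ring
  rw [hcongr, intervalIntegral.integral_const_mul] at hF
  simp only [intervalIntegral.integral_same] at hF
  have hn : (n : ℝ) + 1 ≠ 0 := by positivity
  rw [eq_div_iff hn]
  simp at hF
  linarith

/-- A complex primitive of an integrable function is absolutely continuous. -/
theorem ac_primitive {f : ℝ → ℂ} (hf : IntervalIntegrable f volume 0 π) (c : ℂ) :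
    AbsolutelyContinuousOnInterval (fun x => c + ∫ t in π..x, f t) 0 π := by
  have hG := hf.norm.absolutelyContinuousOnInterval_intervalIntegral (c := π) (by simp)
  unfold AbsolutelyContinuousOnInterval at hG ⊢
  refine squeeze_zero' (Eventually.of_forall fun _ => Finset.sum_nonneg fun i _ => dist_nonneg)
    ?_ hG
  rw [eventually_inf_principal]
  filter_upwards with ⟨n, I⟩ hnI
  refine Finset.sum_le_sum fun i hi => ?_
  have hmem := hnI.1 i hi
  have hI : ∀ u ∈ uIcc (0 : ℝ) π, IntervalIntegrable f volume π u := fun u hu =>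
    hf.mono_set (uIcc_subset_uIcc (by simp) hu)
  have h1 := hI _ hmem.1
  have h2 := hI _ hmem.2
  simp only [dist_add_left]
  rw [dist_eq_norm, dist_eq_norm, intervalIntegral.integral_interval_sub_left h1 h2,
    intervalIntegral.integral_interval_sub_left h1.norm h2.norm]
  exact intervalIntegral.norm_integral_le_abs_integral_norm

/-- An absolutely continuous function is recovered from its a.e. derivative. -/
theorem eq_add_integral_of_ac {y f : ℝ → ℂ} (hy : AbsolutelyContinuousOnInterval y 0 π)
    (hf : IntervalIntegrable f volume 0 π)
    (hd : ∀ᵐ x ∂volume.restrict (Ioo 0 π), HasDerivAt y (f x) x) :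
    ∀ x ∈ Icc 0 π, y x = y π + ∫ t in π..x, f t := by
  have hg := hy.sub (ac_primitive hf (y π))
  have h0 : ∀ᵐ x, x ≠ (0 : ℝ) := by simp [ae_iff, measure_singleton]
  have h1 : ∀ᵐ x, x ≠ π := by simp [ae_iff, measure_singleton]
  rw [ae_restrict_iff' measurableSet_Ioo] at hd
  obtain ⟨C, hC⟩ := hg.const_of_ae_hasDerivAt_zero (by
    filter_upwards [hf.ae_hasDerivAt_integral, hd, h0, h1] with x hx hdx hx0 hx1 hxm
    have hxm' := hxm
    rw [uIcc_of_le pi_pos.le] at hxm'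
    have := (hdx ⟨lt_of_le_of_ne hxm'.1 (Ne.symm hx0), lt_of_le_of_ne hxm'.2 hx1⟩).sub
      ((hx hxm π (by simp)).const_add (y π))
    simpa using this)
  intro x hx
  have e1 := hC x (by rwa [uIcc_of_le pi_pos.le])
  have e2 := hC π (by simp)
  simp only [Pi.sub_apply, intervalIntegral.integral_same] at e1 e2
  have : C = 0 := by rw [← e2]; ring
  rw [this] at e1
  exact sub_eq_zero.mp e1

/-- The right-hand side of the first-order system for `(y, y₁)`. -/
def slRhs (σ : ℝ → ℂ) (lam : ℂ) (t : ℝ) (Y : ℂ × ℂ) : ℂ × ℂ :=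
  (Y.2 + σ t * Y.1, -(σ t * Y.2) - (σ t ^ 2 + lam) * Y.1)

/-- The Lipschitz constant of `slRhs σ lam t`. -/
noncomputable def slBound (σ : ℝ → ℂ) (lam : ℂ) (t : ℝ) : ℝ :=
  1 + ‖σ t‖ + ‖σ t‖ ^ 2 + ‖lam‖

theorem slRhs_sub (σ : ℝ → ℂ) (lam : ℂ) (t : ℝ) (Y Z : ℂ × ℂ) :
    slRhs σ lam t Y - slRhs σ lam t Z = slRhs σ lam t (Y - Z) := by
  ext <;> simp [slRhs] <;> ring

theorem norm_slRhs_le (σ : ℝ → ℂ) (lam : ℂ) (t : ℝ) (Y : ℂ × ℂ) :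
    ‖slRhs σ lam t Y‖ ≤ slBound σ lam t * ‖Y‖ := by
  have h1 := norm_fst_le Y
  have h2 := norm_snd_le Y
  have hs := norm_nonneg (σ t)
  have hl := norm_nonneg lam
  have hY := norm_nonneg Y
  rw [Prod.norm_def]
  refine max_le ?_ ?_
  · calc ‖Y.2 + σ t * Y.1‖ ≤ ‖Y.2‖ + ‖σ t‖ * ‖Y.1‖ := by
          grw [norm_add_le, norm_mul]
      _ ≤ ‖Y‖ + ‖σ t‖ * ‖Y‖ := by gcongr
      _ ≤ slBound σ lam t * ‖Y‖ := by
          unfold slBound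
          nlinarith [mul_nonneg (sq_nonneg ‖σ t‖) hY, mul_nonneg hl hY]
  · calc ‖-(σ t * Y.2) - (σ t ^ 2 + lam) * Y.1‖
          ≤ ‖σ t‖ * ‖Y.2‖ + (‖σ t‖ ^ 2 + ‖lam‖) * ‖Y.1‖ := by
          grw [norm_sub_le, norm_neg, norm_mul, norm_mul, norm_add_le, norm_pow]
      _ ≤ ‖σ t‖ * ‖Y‖ + (‖σ t‖ ^ 2 + ‖lam‖) * ‖Y‖ := by gcongr
      _ ≤ slBound σ lam t * ‖Y‖ := by
          unfold slBound
          nlinarith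

theorem intervalIntegrable_of_memLp {σ : ℝ → ℂ} (hσ : MemLp σ 2 (volume.restrict (Ioo 0 π))) :
    IntervalIntegrable σ volume 0 π ∧ IntervalIntegrable (fun t => σ t ^ 2) volume 0 π ∧
    IntervalIntegrable (fun t => ‖σ t‖ ^ 2) volume 0 π := by
  have hI : ∀ {E : Type} [NormedAddCommGroup E] {f : ℝ → E},
      Integrable f (volume.restrict (Ioo 0 π)) → IntervalIntegrable f volume 0 π := fun hf =>
    ((intervalIntegrable_iff_integrableOn_Ioc_of_le pi_pos.le).mpr
      (by rw [integrableOn_Ioc_iff_integrableOn_Ioo]; exact hf))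
  have h2 : Integrable (fun t => ‖σ t‖ ^ 2) (volume.restrict (Ioo 0 π)) :=
    hσ.integrable_norm_pow (by norm_num)
  refine ⟨hI (hσ.integrable (by norm_num)), hI ?_, hI h2⟩
  refine h2.mono' (hσ.1.pow 2) (Eventually.of_forall fun t => by simp)

theorem intervalIntegrable_slBound {σ : ℝ → ℂ} (hσ : MemLp σ 2 (volume.restrict (Ioo 0 π)))
    (lam : ℂ) : IntervalIntegrable (slBound σ lam) volume 0 π := by
  obtain ⟨h1, -, h3⟩ := intervalIntegrable_of_memLp hσ
  exact ((intervalIntegrable_const.add h1.norm).add h3).add intervalIntegrable_const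

theorem intervalIntegrable_slRhs {σ : ℝ → ℂ} (hσ : MemLp σ 2 (volume.restrict (Ioo 0 π)))
    (lam : ℂ) {Y : ℝ → ℂ × ℂ} (hY : ContinuousOn Y (uIcc 0 π)) :
    IntervalIntegrable (fun t => slRhs σ lam t (Y t)) volume 0 π := by
  obtain ⟨h1, h2, -⟩ := intervalIntegrable_of_memLp hσ
  have c1 : ContinuousOn (fun t => (Y t).1) (uIcc 0 π) := continuous_fst.comp_continuousOn hY
  have c2 : ContinuousOn (fun t => (Y t).2) (uIcc 0 π) := continuous_snd.comp_continuousOn hY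
  have e1 := c2.intervalIntegrable.add (h1.mul_continuousOn c1)
  have e2 := (h1.mul_continuousOn c2).neg.sub
    ((h2.add intervalIntegrable_const).mul_continuousOn (g := fun t => (Y t).1) c1 (f := _)
      (μ := volume) |> fun h : IntervalIntegrable (fun t => (σ t ^ 2 + lam) * (Y t).1) _ _ _ => h)
  exact ⟨e1.1.prodMk e2.1, e1.2.prodMk e2.2⟩

/-- The Picard step: one integration of the system gains one factor of the Volterra bound. -/
theorem norm_integral_slRhs_le {σ : ℝ → ℂ} (hσ : MemLp σ 2 (volume.restrict (Ioo 0 π)))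
    (lam : ℂ) {u : ℝ → ℂ × ℂ} {C : ℝ} (n : ℕ)
    (hu : ∀ t ∈ Icc 0 π, ‖u t‖ ≤ C * ((∫ s in t..π, slBound σ lam s) ^ n / n.factorial))
    {x : ℝ} (hx : x ∈ Icc 0 π) :
    ‖∫ t in π..x, slRhs σ lam t (u t)‖
      ≤ C * ((∫ s in x..π, slBound σ lam s) ^ (n + 1) / (n + 1).factorial) := by
  have hb := intervalIntegrable_slBound hσ lam
  have hsub : uIcc x π ⊆ uIcc 0 π := by
    rw [uIcc_of_le hx.2, uIcc_of_le pi_pos.le]; exact Icc_subset_Icc hx.1 le_rfl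
  have hbx := hb.mono_set hsub
  have hcont : ContinuousOn (fun t => ∫ s in t..π, slBound σ lam s) (uIcc x π) := by
    have := (hbx.absolutelyContinuousOnInterval_intervalIntegral (c := π) (by simp)).continuousOn
    refine this.neg.congr fun t _ => ?_
    simp [intervalIntegral.integral_symm π t]
  have hint : IntervalIntegrable (fun t => C / n.factorial *
      (slBound σ lam t * (∫ s in t..π, slBound σ lam s) ^ n)) volume x π :=
    (hbx.mul_continuousOn (hcont.pow n)).const_mul _
  rw [intervalIntegral.integral_symm, norm_neg]
  refine (intervalIntegral.norm_integral_le_of_norm_le hx.2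
    (Eventually.of_forall fun t ht => ?_) hint).trans ?_
  · have ht' : t ∈ Icc 0 π := ⟨hx.1.trans ht.1.le, ht.2⟩
    have hb0 : 0 ≤ slBound σ lam t := by unfold slBound; positivity
    calc ‖slRhs σ lam t (u t)‖ ≤ slBound σ lam t * ‖u t‖ := norm_slRhs_le _ _ _ _
      _ ≤ slBound σ lam t * (C * ((∫ s in t..π, slBound σ lam s) ^ n / n.factorial)) := by
          gcongr; exact hu t ht'
      _ = _ := by ring
  · rw [intervalIntegral.integral_const_mul, integral_mul_primitive_pow hb n hx]
    rw [Nat.factorial_succ]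
    push_cast
    have h1 : (n : ℝ) + 1 ≠ 0 := by positivity
    have h2 : (n.factorial : ℝ) ≠ 0 := by positivity
    apply le_of_eq
    field_simp

theorem intervalIntegral_fst_snd {f : ℝ → ℂ × ℂ} {a b : ℝ} (hf : IntervalIntegrable f volume a b) :
    (∫ t in a..b, f t).1 = ∫ t in a..b, (f t).1 ∧ (∫ t in a..b, f t).2 = ∫ t in a..b, (f t).2 :=
  ⟨((ContinuousLinearMap.fst ℝ ℂ ℂ).intervalIntegral_comp_comm hf).symm,
    ((ContinuousLinearMap.snd ℝ ℂ ℂ).intervalIntegral_comp_comm hf).symm⟩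

/-- The terminal value problem has a solution. -/
theorem exists_isSLSolution {σ : ℝ → ℂ} (hσ : MemLp σ 2 (volume.restrict (Ioo 0 π)))
    (lam a b : ℂ) :
    ∃ Y : (ℝ → ℂ) × (ℝ → ℂ), IsSLSolution σ lam Y.1 Y.2 ∧ Y.1 π = a ∧ Y.2 π = b := by
  let ext : C(Icc (0 : ℝ) π, ℂ × ℂ) → ℝ → ℂ × ℂ := fun Y t => Y (projIcc 0 π pi_pos.le t)
  have hext : ∀ Y, Continuous (ext Y) := fun Y => Y.continuous.comp continuous_projIcc
  have hint : ∀ Y, IntervalIntegrable (fun t => slRhs σ lam t (ext Y t)) volume 0 π :=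
    fun Y => intervalIntegrable_slRhs hσ lam (hext Y).continuousOn
  have hcomp : ∀ Y, IntervalIntegrable (fun t => (slRhs σ lam t (ext Y t)).1) volume 0 π ∧
      IntervalIntegrable (fun t => (slRhs σ lam t (ext Y t)).2) volume 0 π := fun Y =>
    ⟨⟨(hint Y).1.fst, (hint Y).2.fst⟩, ⟨(hint Y).1.snd, (hint Y).2.snd⟩⟩
  have hsubπ : ∀ x ∈ Icc (0 : ℝ) π, uIcc π x ⊆ uIcc 0 π := fun x hx =>
    uIcc_subset_uIcc (by simp) (by rwa [uIcc_of_le pi_pos.le])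
  have hTc : ∀ Y, ContinuousOn (fun x => (a, b) + ∫ t in π..x, slRhs σ lam t (ext Y t))
      (Icc 0 π) := by
    intro Y
    have h1 := (ac_primitive (hcomp Y).1 a).continuousOn
    have h2 := (ac_primitive (hcomp Y).2 b).continuousOn
    rw [uIcc_of_le pi_pos.le] at h1 h2
    refine (h1.prodMk h2).congr fun x hx => ?_
    obtain ⟨e1, e2⟩ := intervalIntegral_fst_snd ((hint Y).mono_set (hsubπ x hx))
    ext <;> simp [e1, e2]
  let T : C(Icc (0 : ℝ) π, ℂ × ℂ) → C(Icc (0 : ℝ) π, ℂ × ℂ) := fun Y =>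
    ⟨fun x => (a, b) + ∫ t in π..(x : ℝ), slRhs σ lam t (ext Y t),
      continuousOn_iff_continuous_domRestrict.mp (hTc Y)⟩
  have hT : ∀ Y, ∀ x ∈ Icc (0 : ℝ) π,
      ext (T Y) x = (a, b) + ∫ t in π..x, slRhs σ lam t (ext Y t) := by
    intro Y x hx
    have hp : (projIcc 0 π pi_pos.le x : ℝ) = x := by simp [projIcc_of_mem pi_pos.le hx]
    change (a, b) + ∫ t in π..(projIcc 0 π pi_pos.le x : ℝ), slRhs σ lam t (ext Y t) = _
    rw [hp]
  have hiter : ∀ (n : ℕ) (Y Z : C(Icc (0 : ℝ) π, ℂ × ℂ)), ∀ t ∈ Icc (0 : ℝ) π,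
      ‖ext (T^[n] Y) t - ext (T^[n] Z) t‖
        ≤ dist Y Z * ((∫ s in t..π, slBound σ lam s) ^ n / n.factorial) := by
    intro n Y Z
    induction n with
    | zero =>
      intro t _
      simpa [ext, dist_eq_norm] using
        ContinuousMap.dist_apply_le_dist (f := Y) (g := Z) (projIcc 0 π pi_pos.le t)
    | succ k ih =>
      intro x hx
      have key := norm_integral_slRhs_le hσ lam k ih hx
      refine le_trans (le_of_eq ?_) key
      congr 1
      rw [Function.iterate_succ_apply', Function.iterate_succ_apply', hT _ x hx, hT _ x hx,
        add_sub_add_left_eq_sub, ← intervalIntegral.integral_sub ((hint _).mono_set (hsubπ x hx))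
        ((hint _).mono_set (hsubπ x hx))]
      simp only [slRhs_sub]
  have hb := intervalIntegrable_slBound hσ lam
  have hb0 : ∀ t, 0 ≤ slBound σ lam t := fun t => by unfold slBound; positivity
  set H := ∫ s in (0 : ℝ)..π, slBound σ lam s with hH
  have hHnn : 0 ≤ H := intervalIntegral.integral_nonneg pi_pos.le fun t _ => hb0 t
  obtain ⟨n, hn⟩ := ((FloorSemiring.tendsto_pow_div_factorial_atTop H).eventually
    (gt_mem_nhds (show (0 : ℝ) < 1 by norm_num))).exists
  have hcontr : ContractingWith (H ^ n / n.factorial).toNNReal T^[n] := by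
    refine ⟨Real.toNNReal_lt_one.mpr hn, LipschitzWith.of_dist_le_mul fun Y Z => ?_⟩
    rw [ContinuousMap.dist_le (mul_nonneg (NNReal.coe_nonneg _) dist_nonneg),
      Real.coe_toNNReal _ (div_nonneg (pow_nonneg hHnn n) (Nat.cast_nonneg _))]
    intro x
    have hx := hiter n Y Z x x.2
    simp only [ext, projIcc_val] at hx
    rw [dist_eq_norm]
    refine hx.trans ?_
    rw [mul_comm]
    have hsplit : (∫ s in (x : ℝ)..π, slBound σ lam s) ≤ H := by
      refine intervalIntegral.integral_mono_interval x.2.1 x.2.2 le_rfl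
        (Eventually.of_forall fun t => hb0 t) hb
    have hnn : 0 ≤ ∫ s in (x : ℝ)..π, slBound σ lam s :=
      intervalIntegral.integral_nonneg x.2.2 fun t _ => hb0 t
    change _ ≤ H ^ n / n.factorial * dist Y Z
    gcongr
  obtain ⟨Y, hY⟩ : ∃ Y, T Y = Y := ⟨_, hcontr.isFixedPt_fixedPoint_iterate⟩
  have hfix : ∀ x ∈ Icc (0 : ℝ) π,
      ext Y x = (a + ∫ t in π..x, (slRhs σ lam t (ext Y t)).1,
        b + ∫ t in π..x, (slRhs σ lam t (ext Y t)).2) := by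
    intro x hx
    obtain ⟨e1, e2⟩ := intervalIntegral_fst_snd ((hint Y).mono_set (hsubπ x hx))
    have := hT Y x hx
    rw [hY] at this
    rw [this]
    ext <;> simp [e1, e2]
  refine ⟨(fun x => a + ∫ t in π..x, (slRhs σ lam t (ext Y t)).1,
    fun x => b + ∫ t in π..x, (slRhs σ lam t (ext Y t)).2),
    ⟨ac_primitive (hcomp Y).1 a, ac_primitive (hcomp Y).2 b, ?_, ?_⟩, by simp, by simp⟩
  · rw [ae_restrict_iff' measurableSet_Ioo]
    filter_upwards [(hcomp Y).1.ae_hasDerivAt_integral] with x hx hxm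
    have hxm' : x ∈ Icc 0 π := Ioo_subset_Icc_self hxm
    refine ⟨_, (hx (by rwa [uIcc_of_le pi_pos.le]) π (by simp)).const_add a, ?_⟩
    have e := hfix x hxm'
    have e1 := congrArg Prod.fst e
    have e2 := congrArg Prod.snd e
    dsimp only at e1 e2 ⊢
    rw [← e1, ← e2]
    simp [slRhs]
  · rw [ae_restrict_iff' measurableSet_Ioo]
    filter_upwards [(hcomp Y).2.ae_hasDerivAt_integral] with x hx hxm
    have hxm' : x ∈ Icc 0 π := Ioo_subset_Icc_self hxm
    refine ⟨_, (hx (by rwa [uIcc_of_le pi_pos.le]) π (by simp)).const_add b, ?_⟩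
    have e := hfix x hxm'
    have e1 := congrArg Prod.fst e
    have e2 := congrArg Prod.snd e
    dsimp only at e1 e2 ⊢
    rw [← e1, ← e2]
    simp only [slRhs]
    ring

/-- The terminal value problem has at most one solution on `[0, π]`. -/
theorem IsSLSolution.unique {σ : ℝ → ℂ} (hσ : MemLp σ 2 (volume.restrict (Ioo 0 π)))
    {lam : ℂ} {y y₁ z z₁ : ℝ → ℂ} (hy : IsSLSolution σ lam y y₁) (hz : IsSLSolution σ lam z z₁)
    (h : y π = z π) (h₁ : y₁ π = z₁ π) :
    ∀ x ∈ Icc 0 π, y x = z x ∧ y₁ x = z₁ x := by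
  have hsubπ : ∀ x ∈ Icc (0 : ℝ) π, uIcc π x ⊆ uIcc 0 π := fun x hx =>
    uIcc_subset_uIcc (by simp) (by rwa [uIcc_of_le pi_pos.le])
  have main : ∀ {y y₁ : ℝ → ℂ}, IsSLSolution σ lam y y₁ →
      IntervalIntegrable (fun t => slRhs σ lam t (y t, y₁ t)) volume 0 π ∧
      ∀ x ∈ Icc (0 : ℝ) π, (y x, y₁ x) = (y π, y₁ π) + ∫ t in π..x, slRhs σ lam t (y t, y₁ t) := by
    intro y y₁ hy
    have hi : IntervalIntegrable (fun t => slRhs σ lam t (y t, y₁ t)) volume 0 π :=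
      intervalIntegrable_slRhs hσ lam (hy.ac.continuousOn.prodMk hy.ac_quasi.continuousOn)
    refine ⟨hi, fun x hx => ?_⟩
    have i1 : IntervalIntegrable (fun t => (slRhs σ lam t (y t, y₁ t)).1) volume 0 π :=
      ⟨hi.1.fst, hi.2.fst⟩
    have i2 : IntervalIntegrable (fun t => (slRhs σ lam t (y t, y₁ t)).2) volume 0 π :=
      ⟨hi.1.snd, hi.2.snd⟩
    have e1 := eq_add_integral_of_ac hy.ac i1 (by
      filter_upwards [hy.quasi] with t ht
      obtain ⟨d, hd, he⟩ := ht
      convert hd using 1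
      simp [slRhs, he]) x hx
    have e2 := eq_add_integral_of_ac hy.ac_quasi i2 (by
      filter_upwards [hy.eqn] with t ht
      obtain ⟨d, hd, he⟩ := ht
      convert hd using 1
      simp only [slRhs]
      linear_combination he) x hx
    obtain ⟨f1, f2⟩ := intervalIntegral_fst_snd (hi.mono_set (hsubπ x hx))
    ext
    · simp [f1, ← e1]
    · simp [f2, ← e2]
  obtain ⟨iy, ey⟩ := main hy
  obtain ⟨iz, ez⟩ := main hz
  let u : ℝ → ℂ × ℂ := fun t => (y t, y₁ t) - (z t, z₁ t)
  have hu : ∀ x ∈ Icc (0 : ℝ) π, u x = ∫ t in π..x, slRhs σ lam t (u t) := by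
    intro x hx
    simp only [u]
    rw [ey x hx, ez x hx, h, h₁, add_sub_add_left_eq_sub,
      ← intervalIntegral.integral_sub (iy.mono_set (hsubπ x hx)) (iz.mono_set (hsubπ x hx))]
    simp only [slRhs_sub]
  have huc : ContinuousOn u (Icc 0 π) := by
    have := (hy.ac.continuousOn.prodMk hy.ac_quasi.continuousOn).sub
      (hz.ac.continuousOn.prodMk hz.ac_quasi.continuousOn)
    rwa [uIcc_of_le pi_pos.le] at this
  obtain ⟨C, hC⟩ := isCompact_Icc.exists_bound_of_continuousOn huc
  have hn : ∀ n : ℕ, ∀ x ∈ Icc (0 : ℝ) π,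
      ‖u x‖ ≤ C * ((∫ s in x..π, slBound σ lam s) ^ n / n.factorial) := by
    intro n
    induction n with
    | zero => intro x hx; simpa using hC x hx
    | succ k ih =>
      intro x hx
      rw [hu x hx]
      exact norm_integral_slRhs_le hσ lam k ih hx
  intro x hx
  have hlim := (FloorSemiring.tendsto_pow_div_factorial_atTop
    (∫ s in x..π, slBound σ lam s)).const_mul C
  rw [mul_zero] at hlim
  have h0 : u x = 0 := norm_le_zero_iff.mp (ge_of_tendsto' hlim fun n => hn n x hx)
  have := sub_eq_zero.mp h0
  exact ⟨congrArg Prod.fst this, congrArg Prod.snd this⟩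

/-- The boundary value problem `L(σ, p₁, p₂, r₁, r₂)` on `(0, π)`: the equation
`-(y^[1])' - σ y^[1] - σ² y = lam y`, `y^[1] = y' - σ y`, with the boundary conditions
`p₁(lam) y^[1](0) - p₂(lam) y(0) = 0` and `r₁(lam) y^[1](π) + r₂(lam) y(π) = 0`. -/
structure PolySLProblem where
  σ : ℝ → ℂ
  p₁ : ℂ[X]
  p₂ : ℂ[X]
  r₁ : ℂ[X]
  r₂ : ℂ[X]
  memLp : MemLp σ 2 (volume.restrict (Ioo 0 π))
  coprime_p : IsCoprime p₁ p₂
  coprime_r : IsCoprime r₁ r₂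

/-- The normalization of the pair `(r₁, r₂)`; the zero polynomial has degree `⊥`. -/
def IsNormalizedPair (r₁ r₂ : ℂ[X]) : Prop :=
  (r₂.degree ≤ r₁.degree ∧ r₁.leadingCoeff = 1) ∨ (r₁.degree < r₂.degree ∧ r₂.leadingCoeff = 1)

namespace PolySLProblem

/-- The pair `(ψ(·, lam), ψ^[1](·, lam))`: the solution, unique on `[0, π]`, with
`ψ(π, lam) = r₁(lam)` and `ψ^[1](π, lam) = -r₂(lam)`. -/
noncomputable def psiPair (L : PolySLProblem) (lam : ℂ) : (ℝ → ℂ) × (ℝ → ℂ) :=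
  (exists_isSLSolution L.memLp lam (L.r₁.eval lam) (-L.r₂.eval lam)).choose

/-- `ψ(x, lam)`. -/
noncomputable def psi (L : PolySLProblem) (x : ℝ) (lam : ℂ) : ℂ := (L.psiPair lam).1 x

/-- The quasi-derivative `ψ^[1](x, lam)`. -/
noncomputable def psiQuasi (L : PolySLProblem) (x : ℝ) (lam : ℂ) : ℂ := (L.psiPair lam).2 x

theorem psi_spec (L : PolySLProblem) (lam : ℂ) :
    IsSLSolution L.σ lam (fun x => L.psi x lam) (fun x => L.psiQuasi x lam) ∧
      L.psi π lam = L.r₁.eval lam ∧ L.psiQuasi π lam = -L.r₂.eval lam :=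
  (exists_isSLSolution L.memLp lam (L.r₁.eval lam) (-L.r₂.eval lam)).choose_spec

/-- The denominator of the Weyl function, `p₁(lam) ψ^[1](0, lam) - p₂(lam) ψ(0, lam)`. -/
noncomputable def weylDenom (L : PolySLProblem) (lam : ℂ) : ℂ :=
  L.p₁.eval lam * L.psiQuasi 0 lam - L.p₂.eval lam * L.psi 0 lam

/-- The Weyl function `M¹(lam)`; this is its value wherever `L.weylDenom lam ≠ 0`. -/
noncomputable def weylFunction (L : PolySLProblem) (lam : ℂ) : ℂ :=
  -(L.psi 0 lam / L.weylDenom lam)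

end PolySLProblem

/-!
The Weyl function determines `m(lam) = ψ^[1](0, lam) / ψ(0, lam)`, because `p₁` and `p₂` are common
to both problems. Let `c, s` be the solutions with `(c, c^[1])(0) = (1, 0)` and
`(s, s^[1])(0) = (0, 1)`, and mark the second problem by a prime. The transition matrix between the
two fundamental systems has the entry `F(x, lam) = c' s - c s'`, and the whole theorem reduces to
`F = 0`.

* `F(x, ·)` is entire (`differentiable_initialSol`) of order `1/2` (`norm_initialSol_le`).
* Since `m = m'`, replacing `c` by the Weyl solution `c + m s = ψ / ψ(0)`, and `c'` likewise, does
  not change `F`. At `lam = -k²` with `Re k` large, the Weyl solutions are `O(exp (-Re k x))`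
  (`PolySLProblem.exists_psi_bound`) while `s, s'` are `O(exp (Re k x) / ‖k‖)`, so
  `F = O(1 / ‖k‖)` there. Phragmén–Lindelöf and Liouville give `F = 0`
  (`eq_zero_of_decay_of_growth`, `PolySLProblem.cross_eq_zero`).
* The system of differential equations for the transition matrix then forces it to be the identity,
  and `σ = σ'` almost everywhere (`ae_eq_of_cross_eq_zero`). One value of `lam` is enough.
* With equal coefficients the Wronskian of the two functions `ψ` is constant, so it vanishes at `π`
  as it does at `0`; this reads `r₁ r₂' = r₂ r₁'`, and coprimality and the normalization conclude.

All estimates come from the variables `u = k y + y^[1]` and `v = k y - y^[1]`, in which the equation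
at `lam = -k²` is `u' = k u + …`, `v' = -k v + …` with the remaining coefficients bounded by
`‖σ‖ + ‖σ‖² / ‖k‖`. Grönwall's inequality for `‖u‖² + ‖v‖²` gives the upper bounds
(`IsSLSolution.energy_le`). For the lower bound on `ψ(0)`, the boundary data of `ψ` at `π` give
`v(π) = k r₁ + r₂` and `u(π) = k r₁ - r₂`, of the same size by parity in `k`, and integrating towards
`0` the component `v` dominates (`exists_terminal_asymptotics`). The same estimates show that the
denominators of the Weyl functions do not vanish for `Re k` large.
-/

/-! ### Absolutely continuous functions -/

theorem LipschitzOnWith.comp_absolutelyContinuousOnInterval {X Y : Type*} [PseudoMetricSpace X]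
    [PseudoMetricSpace Y] {g : X → Y} {f : ℝ → X} {K : NNReal} {s : Set X} {a b : ℝ}
    (hg : LipschitzOnWith K g s) (hf : AbsolutelyContinuousOnInterval f a b)
    (hfs : MapsTo f (uIcc a b) s) : AbsolutelyContinuousOnInterval (fun x => g (f x)) a b := by
  unfold AbsolutelyContinuousOnInterval at hf ⊢
  refine squeeze_zero' (Eventually.of_forall fun _ => Finset.sum_nonneg fun i _ => dist_nonneg)
    ?_ (by simpa using hf.const_mul (K : ℝ))
  rw [eventually_inf_principal]
  filter_upwards with ⟨n, I⟩ hnI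
  rw [Finset.mul_sum]
  refine Finset.sum_le_sum fun i hi => ?_
  exact hg.dist_le_mul _ (hfs (hnI.1 i hi).1) _ (hfs (hnI.1 i hi).2)

namespace AbsolutelyContinuousOnInterval

theorem norm_sq {f : ℝ → ℂ} {a b : ℝ} (hf : AbsolutelyContinuousOnInterval f a b) :
    AbsolutelyContinuousOnInterval (fun x => ‖f x‖ ^ 2) a b := by
  have h : AbsolutelyContinuousOnInterval (fun x => ‖f x‖) a b :=
    (lipschitzWith_one_norm.lipschitzOnWith (s := univ)).comp_absolutelyContinuousOnInterval hf
      (mapsTo_univ _ _)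
  simpa only [sq] using h.fun_mul h

theorem exp {f : ℝ → ℝ} {a b : ℝ} (hf : AbsolutelyContinuousOnInterval f a b) :
    AbsolutelyContinuousOnInterval (fun x => Real.exp (f x)) a b := by
  obtain ⟨C, hC⟩ := hf.exists_bound
  obtain ⟨K, hK⟩ := (Real.contDiff_exp (n := 1)).contDiffOn.exists_lipschitzOnWith
    (s := Icc (-C) C) (by decide) (convex_Icc _ _) isCompact_Icc
  exact hK.comp_absolutelyContinuousOnInterval hf fun x hx => abs_le.mp (hC x hx)

theorem of_contDiff {E : Type*} [NormedAddCommGroup E] [NormedSpace ℝ E] {f : ℝ → E}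
    (hf : ContDiff ℝ 1 f) (a b : ℝ) : AbsolutelyContinuousOnInterval f a b :=
  hf.contDiffOn.absolutelyContinuousOnInterval

theorem sub_le_integral {f g : ℝ → ℝ} {a b : ℝ} (hab : a ≤ b)
    (hf : AbsolutelyContinuousOnInterval f a b) (hg : IntervalIntegrable g volume a b)
    (h : ∀ᵐ x, x ∈ Ioo a b → ∃ d, HasDerivAt f d x ∧ d ≤ g x) :
    f b - f a ≤ ∫ x in a..b, g x := by
  rw [← hf.integral_deriv_eq_sub]
  refine intervalIntegral.integral_mono_ae_restrict hab hf.intervalIntegrable_deriv hg ?_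
  rw [EventuallyLE, ae_restrict_iff' measurableSet_Icc]
  have h0 : ∀ᵐ x, x ≠ a := by simp [ae_iff, measure_singleton]
  have h1 : ∀ᵐ x, x ≠ b := by simp [ae_iff, measure_singleton]
  filter_upwards [h, h0, h1] with x hx hxa hxb hxm
  obtain ⟨d, hd, hle⟩ := hx ⟨lt_of_le_of_ne hxm.1 (Ne.symm hxa), lt_of_le_of_ne hxm.2 hxb⟩
  rwa [hd.deriv]

theorem norm_sub_le_integral {f : ℝ → ℂ} {g : ℝ → ℝ} {a b : ℝ} (hab : a ≤ b)
    (hf : AbsolutelyContinuousOnInterval f a b) (hg : IntervalIntegrable g volume a b)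
    (h : ∀ᵐ x, x ∈ Ioo a b → ∃ d, HasDerivAt f d x ∧ ‖d‖ ≤ g x) :
    ‖f b - f a‖ ≤ ∫ x in a..b, g x := by
  -- Apply the real inequality to `Re (c f)`, where `c` rotates `f b - f a` to its norm.
  obtain ⟨c, hc, hcf⟩ : ∃ c : ℂ, ‖c‖ ≤ 1 ∧ (c * (f b - f a)).re = ‖f b - f a‖ := by
    generalize f b - f a = z
    rcases eq_or_ne z 0 with hz | hz
    · exact ⟨0, by simp, by simp [hz]⟩
    · refine ⟨(starRingEnd ℂ) z / ‖z‖, ?_, ?_⟩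
      · simp [hz]
      · rw [div_mul_eq_mul_div, ← Complex.normSq_eq_conj_mul_self, Complex.normSq_eq_norm_sq]
        have : (‖z‖ : ℂ) ≠ 0 := by simpa using hz
        push_cast
        rw [sq, mul_div_assoc, div_self this]
        simp
  have hre : AbsolutelyContinuousOnInterval (fun x => (c * f x).re) a b :=
    (Complex.reCLM.lipschitz.lipschitzOnWith (s := univ)).comp_absolutelyContinuousOnInterval
      (f := fun x => c * f x) (hf.const_smul c) (mapsTo_univ _ _)
  have key := hre.sub_le_integral hab hg (by
    filter_upwards [h] with x hx hxm
    obtain ⟨d, hd, hle⟩ := hx hxm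
    refine ⟨(c * d).re, ?_, ?_⟩
    · exact Complex.reCLM.hasFDerivAt.comp_hasDerivAt x (hd.const_mul c)
    calc (c * d).re ≤ ‖c * d‖ := Complex.re_le_norm _
      _ = ‖c‖ * ‖d‖ := norm_mul _ _
      _ ≤ ‖d‖ := mul_le_of_le_one_left (norm_nonneg d) hc
      _ ≤ g x := hle)
  rwa [← Complex.sub_re, ← mul_sub, hcf] at key

/-- Grönwall's inequality in both directions of the interval, with an integrable rate. -/
theorem le_mul_exp_abs_integral {E g : ℝ → ℝ} {a b : ℝ} (hab : a ≤ b)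
    (hE : AbsolutelyContinuousOnInterval E a b) (hE0 : ∀ x, 0 ≤ E x)
    (hg : IntervalIntegrable g volume a b)
    (h : ∀ᵐ x, x ∈ Ioo a b → ∃ d, HasDerivAt E d x ∧ |d| ≤ g x * E x)
    {s x : ℝ} (hs : s ∈ Icc a b) (hx : x ∈ Icc a b) :
    E x ≤ E s * Real.exp |∫ t in s..x, g t| := by
  have hs' : s ∈ uIcc a b := by rwa [uIcc_of_le hab]
  have hx' : x ∈ uIcc a b := by rwa [uIcc_of_le hab]
  have hG : AbsolutelyContinuousOnInterval (fun x => ∫ t in s..x, g t) a b :=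
    hg.absolutelyContinuousOnInterval_intervalIntegral hs'
  have hGd := hg.ae_hasDerivAt_integral
  rcases le_total s x with hsx | hsx
  · have hsub : uIcc s x ⊆ uIcc a b := uIcc_subset_uIcc hs' hx'
    have hac : AbsolutelyContinuousOnInterval
        (fun x => E x * Real.exp (-∫ t in s..x, g t)) s x :=
      (hE.fun_mul hG.fun_neg.exp).mono hsub
    have key := hac.sub_le_integral hsx (g := fun _ => 0) intervalIntegrable_const (by
      filter_upwards [h, hGd] with t ht hGt htm
      have htm' : t ∈ uIcc a b := hsub (by rw [uIcc_of_le hsx]; exact Ioo_subset_Icc_self htm)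
      obtain ⟨d, hd, hle⟩ := ht ⟨hs.1.trans_lt htm.1, htm.2.trans_le hx.2⟩
      refine ⟨_, hd.fun_mul (hGt htm' s hs').fun_neg.exp, ?_⟩
      have h1 := (abs_le.mp hle).2
      have h2 := Real.exp_pos (-∫ u in s..t, g u)
      nlinarith)
    simp only [intervalIntegral.integral_same, neg_zero, Real.exp_zero, mul_one,
      intervalIntegral.integral_zero, sub_nonpos, Real.exp_neg] at key
    rw [← div_eq_mul_inv, div_le_iff₀ (Real.exp_pos _)] at key
    refine key.trans (mul_le_mul_of_nonneg_left ?_ (hE0 s))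
    exact Real.exp_le_exp.mpr (le_abs_self _)
  · have hsub : uIcc x s ⊆ uIcc a b := uIcc_subset_uIcc hx' hs'
    have hac : AbsolutelyContinuousOnInterval
        (fun x => -(E x * Real.exp (∫ t in s..x, g t))) x s :=
      ((hE.fun_mul hG.exp).mono hsub).fun_neg
    have key := hac.sub_le_integral hsx (g := fun _ => 0) intervalIntegrable_const (by
      filter_upwards [h, hGd] with t ht hGt htm
      have htm' : t ∈ uIcc a b := hsub (by rw [uIcc_of_le hsx]; exact Ioo_subset_Icc_self htm)
      obtain ⟨d, hd, hle⟩ := ht ⟨hx.1.trans_lt htm.1, htm.2.trans_le hs.2⟩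
      refine ⟨_, (hd.fun_mul (hGt htm' s hs').exp).fun_neg, ?_⟩
      have h1 := (abs_le.mp hle).1
      have h2 := Real.exp_pos (∫ u in s..t, g u)
      nlinarith)
    simp only [intervalIntegral.integral_same, Real.exp_zero, mul_one,
      intervalIntegral.integral_zero] at key
    have hexp : Real.exp (-(∫ t in s..x, g t)) ≤ Real.exp |∫ t in s..x, g t| :=
      Real.exp_le_exp.mpr (neg_le_abs _)
    have h3 : E x * Real.exp (∫ t in s..x, g t) ≤ E s := by linarith
    rw [← le_div_iff₀ (Real.exp_pos _), div_eq_mul_inv, ← Real.exp_neg] at h3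
    exact h3.trans (mul_le_mul_of_nonneg_left hexp (hE0 s))

end AbsolutelyContinuousOnInterval

/-! ### Solutions of the Sturm–Liouville equation -/

/-- The fundamental theorem of calculus for absolutely continuous functions, based at `0`. -/
theorem sub_eq_integral_of_ac {y f : ℝ → ℂ} (hy : AbsolutelyContinuousOnInterval y 0 π)
    (hf : IntervalIntegrable f volume 0 π)
    (hd : ∀ᵐ x ∂volume.restrict (Ioo 0 π), HasDerivAt y (f x) x) {x : ℝ} (hx : x ∈ Icc 0 π) :
    y x - y 0 = ∫ t in (0 : ℝ)..x, f t := by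
  have h0 : (0 : ℝ) ∈ Icc 0 π := ⟨le_rfl, pi_pos.le⟩
  have hI : ∀ u ∈ Icc (0 : ℝ) π, IntervalIntegrable f volume π u := fun u hu =>
    hf.mono_set (uIcc_subset_uIcc (by simp) (by rwa [uIcc_of_le pi_pos.le]))
  rw [eq_add_integral_of_ac hy hf hd x hx, eq_add_integral_of_ac hy hf hd 0 h0,
    add_sub_add_left_eq_sub, intervalIntegral.integral_interval_sub_left (hI x hx) (hI 0 h0)]

/-- Absolutely continuous functions with a.e. vanishing derivative on `(0, π)` are constant on
`[0, π]`. -/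
theorem eq_left_of_ac {y : ℝ → ℂ} (hy : AbsolutelyContinuousOnInterval y 0 π)
    (hd : ∀ᵐ x ∂volume.restrict (Ioo 0 π), HasDerivAt y 0 x) {x : ℝ} (hx : x ∈ Icc 0 π) :
    y x = y 0 := by
  have := sub_eq_integral_of_ac hy (f := fun _ => 0) intervalIntegrable_const hd hx
  simpa [sub_eq_zero] using this

namespace IsSLSolution

variable {σ : ℝ → ℂ} {lam mu : ℂ} {y y₁ z z₁ : ℝ → ℂ}

theorem continuousOn (hy : IsSLSolution σ lam y y₁) : ContinuousOn y (Icc 0 π) := by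
  have := hy.ac.continuousOn
  rwa [uIcc_of_le pi_pos.le] at this

theorem hasDerivAt (hy : IsSLSolution σ lam y y₁) :
    ∀ᵐ x ∂volume.restrict (Ioo 0 π), HasDerivAt y (y₁ x + σ x * y x) x ∧
      HasDerivAt y₁ (-(σ x * y₁ x) - (σ x ^ 2 + lam) * y x) x := by
  filter_upwards [hy.quasi, hy.eqn] with x ⟨d, hd, he⟩ ⟨e, hd', he'⟩
  refine ⟨?_, ?_⟩
  · convert hd using 1
    rw [he]; ring
  · convert hd' using 1
    linear_combination he'

theorem of_hasDerivAt (h : AbsolutelyContinuousOnInterval y 0 π)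
    (h₁ : AbsolutelyContinuousOnInterval y₁ 0 π)
    (hd : ∀ᵐ x ∂volume.restrict (Ioo 0 π), HasDerivAt y (y₁ x + σ x * y x) x ∧
      HasDerivAt y₁ (-(σ x * y₁ x) - (σ x ^ 2 + lam) * y x) x) : IsSLSolution σ lam y y₁ := by
  refine ⟨h, h₁, ?_, ?_⟩
  · filter_upwards [hd] with x hx
    exact ⟨_, hx.1, by ring⟩
  · filter_upwards [hd] with x hx
    exact ⟨_, hx.2, by ring⟩

theorem linearCombination (hy : IsSLSolution σ lam y y₁) (hz : IsSLSolution σ lam z z₁)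
    (a b : ℂ) :
    IsSLSolution σ lam (fun x => a * y x + b * z x) (fun x => a * y₁ x + b * z₁ x) := by
  refine of_hasDerivAt ((hy.ac.const_smul a).fun_add (hz.ac.const_smul b))
    ((hy.ac_quasi.const_smul a).fun_add (hz.ac_quasi.const_smul b)) ?_
  filter_upwards [hy.hasDerivAt, hz.hasDerivAt] with x hx hx'
  refine ⟨?_, ?_⟩
  · refine ((hx.1.const_mul a).fun_add (hx'.1.const_mul b)).congr_deriv ?_
    ring
  · refine ((hx.2.const_mul a).fun_add (hx'.2.const_mul b)).congr_deriv ?_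
    ring

theorem congr_coeff {σ' : ℝ → ℂ} (hy : IsSLSolution σ lam y y₁)
    (h : ∀ᵐ x ∂volume.restrict (Ioo 0 π), σ x = σ' x) : IsSLSolution σ' lam y y₁ := by
  refine of_hasDerivAt hy.ac hy.ac_quasi ?_
  filter_upwards [hy.hasDerivAt, h] with x hx hs
  rwa [← hs]

/-- Lagrange's identity for the quasi-derivative Wronskian of solutions at two spectral
parameters. -/
theorem wronskian_eq (hy : IsSLSolution σ lam y y₁) (hz : IsSLSolution σ mu z z₁)
    {x : ℝ} (hx : x ∈ Icc 0 π) :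
    y x * z₁ x - y₁ x * z x
      = y 0 * z₁ 0 - y₁ 0 * z 0 + (lam - mu) * ∫ t in (0 : ℝ)..x, y t * z t := by
  rw [← intervalIntegral.integral_const_mul, ← sub_eq_iff_eq_add']
  refine sub_eq_integral_of_ac (y := fun x => y x * z₁ x - y₁ x * z x)
    ((hy.ac.fun_smul hz.ac_quasi).fun_sub (hy.ac_quasi.fun_smul hz.ac)) ?_ ?_ hx
  · exact ((hy.ac.continuousOn.mul hz.ac.continuousOn).intervalIntegrable).const_mul _
  · filter_upwards [hy.hasDerivAt, hz.hasDerivAt] with x hx hx'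
    refine ((hx.1.fun_mul hx'.2).fun_sub (hx.2.fun_mul hx'.1)).congr_deriv ?_
    ring

/-- Variation of constants: a solution at `lam` in terms of a fundamental system at `mu`
normalized at `0`. -/
theorem variation_of_constants {c c₁ s s₁ : ℝ → ℂ} (hy : IsSLSolution σ lam y y₁)
    (hc : IsSLSolution σ mu c c₁) (hs : IsSLSolution σ mu s s₁)
    (hc0 : c 0 = 1) (hc₁0 : c₁ 0 = 0) (hs0 : s 0 = 0) (hs₁0 : s₁ 0 = 1)
    {x : ℝ} (hx : x ∈ Icc 0 π) :
    y x = y 0 * c x + y₁ 0 * s x + (lam - mu) *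
      (c x * (∫ t in (0 : ℝ)..x, y t * s t) - s x * ∫ t in (0 : ℝ)..x, y t * c t) := by
  have h1 := hy.wronskian_eq hs hx
  have h2 := hy.wronskian_eq hc hx
  have h3 := hc.wronskian_eq hs hx
  rw [hs0, hs₁0] at h1 h3
  rw [hc0, hc₁0] at h2 h3
  simp only [sub_self, zero_mul, mul_zero, add_zero, sub_zero, mul_one] at h1 h2 h3
  linear_combination c x * h1 - s x * h2 - y x * h3

/-- The integrand bounds the logarithmic derivative of the energy `‖k y + y₁‖² + ‖k y - y₁‖²`
beyond `2 Re k`. -/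
theorem intervalIntegrable_rate (hσ : MemLp σ 2 (volume.restrict (Ioo 0 π))) (lam k : ℂ) :
    IntervalIntegrable (fun t => 2 * ‖σ t‖ + 2 * ‖σ t ^ 2 + lam + k ^ 2‖ / ‖k‖) volume 0 π := by
  obtain ⟨h1, h2, -⟩ := intervalIntegrable_of_memLp hσ
  exact (h1.norm.const_mul 2).add
    ((((h2.add intervalIntegrable_const).add intervalIntegrable_const).norm.const_mul 2).div_const _)

/-- The equation in the variables `k y ± y₁`, which diagonalize its constant part. No relation
between `k` and `lam` is assumed; the choice `lam = -k²` makes the coupling small for large `k`. -/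
theorem hasDerivAt_add_sub (hy : IsSLSolution σ lam y y₁) {k : ℂ} (hk : k ≠ 0) :
    ∀ᵐ x ∂volume.restrict (Ioo 0 π),
      HasDerivAt (fun x => k * y x + y₁ x) (k * (k * y x + y₁ x) + (σ x * (k * y x - y₁ x) -
        (σ x ^ 2 + lam + k ^ 2) / (2 * k) * ((k * y x + y₁ x) + (k * y x - y₁ x)))) x ∧
      HasDerivAt (fun x => k * y x - y₁ x) (-(k * (k * y x - y₁ x)) + (σ x * (k * y x + y₁ x) +
        (σ x ^ 2 + lam + k ^ 2) / (2 * k) * ((k * y x + y₁ x) + (k * y x - y₁ x)))) x := by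
  filter_upwards [hy.hasDerivAt] with x hx
  refine ⟨?_, ?_⟩
  · refine ((hx.1.const_mul k).fun_add hx.2).congr_deriv ?_
    field_simp
    ring
  · refine ((hx.1.const_mul k).fun_sub hx.2).congr_deriv ?_
    field_simp
    ring

/-- Grönwall's inequality for the energy `‖k y + y₁‖² + ‖k y - y₁‖²`, valid in both directions of
the interval. -/
theorem energy_le (hσ : MemLp σ 2 (volume.restrict (Ioo 0 π))) (hy : IsSLSolution σ lam y y₁)
    {k : ℂ} (hk : k ≠ 0) (hkre : 0 ≤ k.re) {s x : ℝ} (hs : s ∈ Icc 0 π) (hx : x ∈ Icc 0 π) :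
    ‖k * y x + y₁ x‖ ^ 2 + ‖k * y x - y₁ x‖ ^ 2
      ≤ (‖k * y s + y₁ s‖ ^ 2 + ‖k * y s - y₁ s‖ ^ 2) * Real.exp (2 * k.re * |x - s| +
        ∫ t in (0 : ℝ)..π, (2 * ‖σ t‖ + 2 * ‖σ t ^ 2 + lam + k ^ 2‖ / ‖k‖)) := by
  set r : ℝ → ℝ := fun t => 2 * ‖σ t‖ + 2 * ‖σ t ^ 2 + lam + k ^ 2‖ / ‖k‖ with hr
  have hrint : IntervalIntegrable r volume 0 π := intervalIntegrable_rate hσ lam k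
  have hr0 : ∀ t, 0 ≤ r t := fun t => by positivity
  have hu : AbsolutelyContinuousOnInterval (fun x => k * y x + y₁ x) 0 π :=
    (hy.ac.const_smul k).fun_add hy.ac_quasi
  have hv : AbsolutelyContinuousOnInterval (fun x => k * y x - y₁ x) 0 π :=
    (hy.ac.const_smul k).fun_sub hy.ac_quasi
  have key := AbsolutelyContinuousOnInterval.le_mul_exp_abs_integral pi_pos.le
    (hu.norm_sq.fun_add hv.norm_sq) (fun x => by positivity)
    (g := fun t => 2 * k.re + r t) (intervalIntegrable_const.add hrint) (by
      have h := hy.hasDerivAt_add_sub hk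
      rw [ae_restrict_iff' measurableSet_Ioo] at h
      filter_upwards [h] with t ht htm
      obtain ⟨h1, h2⟩ := ht htm
      refine ⟨_, h1.norm_sq.fun_add h2.norm_sq, ?_⟩
      generalize k * y t + y₁ t = u
      generalize k * y t - y₁ t = v
      have hq : ‖(σ t ^ 2 + lam + k ^ 2) / (2 * k)‖ = ‖σ t ^ 2 + lam + k ^ 2‖ / ‖k‖ / 2 := by
        rw [norm_div, norm_mul, RCLike.norm_ofNat, mul_comm, div_div]
      simp only [hr, mul_div_assoc]
      generalize (σ t ^ 2 + lam + k ^ 2) / (2 * k) = q at hq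
      generalize ‖σ t ^ 2 + lam + k ^ 2‖ / ‖k‖ = Q at hq
      have hQ : Q = 2 * ‖q‖ := by linarith
      subst hQ
      have e1 : inner ℝ u (k * u) = k.re * ‖u‖ ^ 2 := by
        rw [Complex.inner, ← Complex.normSq_eq_norm_sq, Complex.normSq_apply]
        simp; ring
      have e2 : inner ℝ v (k * v) = k.re * ‖v‖ ^ 2 := by
        rw [Complex.inner, ← Complex.normSq_eq_norm_sq, Complex.normSq_apply]
        simp; ring
      rw [inner_add_right, inner_add_right, inner_neg_right, e1, e2]
      have b1 := abs_real_inner_le_norm u (σ t * v - q * (u + v))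
      have b2 := abs_real_inner_le_norm v (σ t * u + q * (u + v))
      have c1 : ‖σ t * v - q * (u + v)‖ ≤ ‖σ t‖ * ‖v‖ + ‖q‖ * (‖u‖ + ‖v‖) := by
        grw [norm_sub_le, norm_mul, norm_mul, norm_add_le]
      have c2 : ‖σ t * u + q * (u + v)‖ ≤ ‖σ t‖ * ‖u‖ + ‖q‖ * (‖u‖ + ‖v‖) := by
        grw [norm_add_le, norm_mul, norm_mul, norm_add_le]
      have d1 := b1.trans (mul_le_mul_of_nonneg_left c1 (norm_nonneg u))
      have d2 := b2.trans (mul_le_mul_of_nonneg_left c2 (norm_nonneg v))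
      have f1 := mul_nonneg (norm_nonneg (σ t)) (sq_nonneg (‖u‖ - ‖v‖))
      have f2 := mul_nonneg (norm_nonneg q) (sq_nonneg (‖u‖ - ‖v‖))
      have f3 := mul_nonneg hkre (sq_nonneg ‖u‖)
      have f4 := mul_nonneg hkre (sq_nonneg ‖v‖)
      rw [abs_le] at d1 d2 ⊢
      constructor <;> nlinarith) hs hx
  refine key.trans (mul_le_mul_of_nonneg_left (Real.exp_le_exp.mpr ?_) (by positivity))
  have hsx : IntervalIntegrable r volume s x := hrint.mono_set
    (uIcc_subset_uIcc (by rwa [uIcc_of_le pi_pos.le]) (by rwa [uIcc_of_le pi_pos.le]))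
  rw [intervalIntegral.integral_add intervalIntegrable_const hsx, intervalIntegral.integral_const,
    smul_eq_mul]
  refine (abs_add_le _ _).trans (add_le_add ?_ ?_)
  · rw [abs_mul, abs_of_nonneg (by positivity : 0 ≤ 2 * k.re), mul_comm]
  · rw [← abs_of_nonneg (intervalIntegral.integral_nonneg pi_pos.le fun t _ => hr0 t)]
    refine intervalIntegral.abs_integral_mono_interval ?_
      (Eventually.of_forall fun t => hr0 t) hrint
    rw [uIoc_of_le pi_pos.le]
    intro t ht
    rcases le_total s x with h | h
    · rw [uIoc_of_le h] at ht
      exact ⟨hs.1.trans_lt ht.1, ht.2.trans hx.2⟩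
    · rw [uIoc_of_ge h] at ht
      exact ⟨hx.1.trans_lt ht.1, ht.2.trans hs.2⟩

end IsSLSolution

/-- The initial value problem at `0` has a solution. -/
theorem exists_isSLSolution_zero {σ : ℝ → ℂ} (hσ : MemLp σ 2 (volume.restrict (Ioo 0 π)))
    (lam a b : ℂ) :
    ∃ Y : (ℝ → ℂ) × (ℝ → ℂ), IsSLSolution σ lam Y.1 Y.2 ∧ Y.1 0 = a ∧ Y.2 0 = b := by
  obtain ⟨C, hC, hCπ, hCπ₁⟩ := exists_isSLSolution hσ lam 1 0
  obtain ⟨S, hS, hSπ, hSπ₁⟩ := exists_isSLSolution hσ lam 0 1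
  -- The Wronskian of the fundamental system normalized at `π` equals `1` at `0` as well.
  have hW := hC.wronskian_eq hS (right_mem_Icc.mpr pi_pos.le)
  rw [hCπ, hCπ₁, hSπ, hSπ₁] at hW
  simp only [sub_self, zero_mul, mul_one, add_zero, sub_zero] at hW
  refine ⟨(_, _), hC.linearCombination hS (a * S.2 0 - b * S.1 0) (b * C.1 0 - a * C.2 0), ?_, ?_⟩
  · linear_combination -a * hW
  · linear_combination -b * hW

/-- The solution pair `(y, y^[1])` at the spectral parameter `lam` with `y(0) = a` and
`y^[1](0) = b`; it is unique on `[0, π]`. -/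
noncomputable def initialSol {σ : ℝ → ℂ} (hσ : MemLp σ 2 (volume.restrict (Ioo 0 π)))
    (a b lam : ℂ) : (ℝ → ℂ) × (ℝ → ℂ) :=
  (exists_isSLSolution_zero hσ lam a b).choose

section initialSol

variable {σ : ℝ → ℂ} (hσ : MemLp σ 2 (volume.restrict (Ioo 0 π))) (a b lam : ℂ)

theorem isSLSolution_initialSol :
    IsSLSolution σ lam (initialSol hσ a b lam).1 (initialSol hσ a b lam).2 :=
  (exists_isSLSolution_zero hσ lam a b).choose_spec.1

theorem initialSol_fst_zero : (initialSol hσ a b lam).1 0 = a :=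
  (exists_isSLSolution_zero hσ lam a b).choose_spec.2.1

theorem initialSol_snd_zero : (initialSol hσ a b lam).2 0 = b :=
  (exists_isSLSolution_zero hσ lam a b).choose_spec.2.2

end initialSol

/-! ### Behaviour of solutions for large spectral parameter -/

/-- The logarithmic growth of solutions beyond `exp (Re k x)`, at `lam = -k²` with `‖k‖ ≥ 1`, is
at most half of this constant. -/
noncomputable def growthConst (σ : ℝ → ℂ) : ℝ := ∫ t in (0 : ℝ)..π, (2 * ‖σ t‖ + 2 * ‖σ t‖ ^ 2)

theorem IsSLSolution.energy_le_growthConst {σ : ℝ → ℂ} {k : ℂ} {y y₁ : ℝ → ℂ}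
    (hσ : MemLp σ 2 (volume.restrict (Ioo 0 π))) (hy : IsSLSolution σ (-k ^ 2) y y₁)
    (hk : 1 ≤ ‖k‖) (hkre : 0 ≤ k.re) {s x : ℝ} (hs : s ∈ Icc 0 π) (hx : x ∈ Icc 0 π) :
    ‖k * y x + y₁ x‖ ^ 2 + ‖k * y x - y₁ x‖ ^ 2
      ≤ (‖k * y s + y₁ s‖ ^ 2 + ‖k * y s - y₁ s‖ ^ 2) *
        Real.exp (2 * k.re * |x - s| + growthConst σ) := by
  have hk0 : k ≠ 0 := norm_pos_iff.mp (by linarith)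
  refine (hy.energy_le hσ hk0 hkre hs hx).trans
    (mul_le_mul_of_nonneg_left (Real.exp_le_exp.mpr ?_) (by positivity))
  obtain ⟨h1, h2, h3⟩ := intervalIntegrable_of_memLp hσ
  refine add_le_add_right (intervalIntegral.integral_mono_on pi_pos.le
    (IsSLSolution.intervalIntegrable_rate hσ _ k)
    ((h1.norm.const_mul 2).add (h3.const_mul 2)) fun t _ => ?_) _
  rw [show σ t ^ 2 + -k ^ 2 + k ^ 2 = σ t ^ 2 by ring, norm_pow]
  gcongr
  exact div_le_self (by positivity) hk

/-- In a system where `a' = 2 k a + h` with `Re k` large and `b'` small with `a`, the component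
`a` is forced to be small at `0`, and `b` hardly changes. The first bound integrates the derivative
of `‖a‖²` to control `∫ ‖a‖²`; the value at `0` comes from the derivative of `(π - x) ‖a‖²`. -/
theorem exists_bound_of_dichotomy {s : ℝ → ℝ} (hs0 : ∀ t, 0 ≤ s t)
    (hs : IntervalIntegrable s volume 0 π) (hs2 : IntervalIntegrable (fun t => s t ^ 2) volume 0 π)
    {B : ℝ} (hB : 0 ≤ B) :
    ∃ K, ∀ k : ℂ, 1 ≤ k.re → ∀ a b : ℝ → ℂ, AbsolutelyContinuousOnInterval a 0 π →
      AbsolutelyContinuousOnInterval b 0 π → (∀ x ∈ Icc 0 π, ‖a x‖ ≤ B) →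
      (∀ᵐ x ∂volume.restrict (Ioo 0 π), ∃ h, HasDerivAt a (2 * k * a x + h) x ∧
        ‖h‖ ≤ B * (s x + s x ^ 2 / k.re)) →
      (∀ᵐ x ∂volume.restrict (Ioo 0 π), ∃ h, HasDerivAt b h x ∧
        ‖h‖ ≤ s x * ‖a x‖ + B * (s x ^ 2 / k.re)) →
      ‖a 0‖ ^ 2 ≤ K / √k.re ∧ ‖b π - b 0‖ ≤ K / √k.re := by
  set N₁ := ∫ t in (0 : ℝ)..π, s t with hN₁
  set N₂ := ∫ t in (0 : ℝ)..π, s t ^ 2 with hN₂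
  have hN₁0 : 0 ≤ N₁ := intervalIntegral.integral_nonneg pi_pos.le fun t _ => hs0 t
  have hN₂0 : 0 ≤ N₂ := intervalIntegral.integral_nonneg pi_pos.le fun t _ => sq_nonneg _
  set X := B ^ 2 * (1 + 2 * N₁ + 2 * N₂) with hX
  have hX0 : 0 ≤ X := by positivity
  refine ⟨(X + 2 * B * (X + N₂) + 2 * B ^ 2 * N₂) + (X + N₂ + B * N₂), ?_⟩
  intro k hk a b ha hb haB had hbd
  set τ := k.re with hτ
  have hτ0 : 0 < τ := by linarith
  have hr0 : 0 < √τ := Real.sqrt_pos.mpr hτ0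
  have hr1 : 1 ≤ √τ := Real.one_le_sqrt.mpr hk
  have hrr : √τ * √τ = τ := Real.mul_self_sqrt hτ0.le
  have hτr : 1 / τ ≤ 1 / √τ := by
    apply one_div_le_one_div_of_le hr0
    nlinarith
  have hD := ha.norm_sq
  have iD : IntervalIntegrable (fun x => ‖a x‖ ^ 2) volume 0 π :=
    hD.continuousOn.intervalIntegrable
  have ias : IntervalIntegrable (fun x => s x * ‖a x‖) volume 0 π :=
    hs.mul_continuousOn ha.continuousOn.norm
  have is2 : IntervalIntegrable (fun x => s x ^ 2 / τ) volume 0 π := hs2.div_const _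
  rw [ae_restrict_iff' measurableSet_Ioo] at had hbd
  have hinner : ∀ z : ℂ, inner ℝ z (2 * k * z) = 2 * τ * ‖z‖ ^ 2 := by
    intro z
    rw [Complex.inner, ← Complex.normSq_eq_norm_sq, Complex.normSq_apply, hτ]
    simp; ring
  set I := ∫ x in (0 : ℝ)..π, ‖a x‖ ^ 2 with hI
  set J := ∫ x in (0 : ℝ)..π, s x * ‖a x‖ with hJ
  have hI0 : 0 ≤ I := intervalIntegral.integral_nonneg pi_pos.le fun t _ => sq_nonneg _
  have hI1 : 4 * τ * I ≤ X := by
    have h := hD.fun_neg.sub_le_integral pi_pos.le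
      (g := fun x => 2 * B ^ 2 * (s x + s x ^ 2 / τ) - 4 * τ * ‖a x‖ ^ 2)
      (((hs.add is2).const_mul _).sub (iD.const_mul _)) (by
        filter_upwards [had] with x hx hxm
        obtain ⟨h, hd, hle⟩ := hx hxm
        refine ⟨_, hd.norm_sq.fun_neg, ?_⟩
        rw [inner_add_right, hinner]
        have h1 := (abs_le.mp (abs_real_inner_le_norm (a x) h)).1
        have h2 : ‖a x‖ * ‖h‖ ≤ B * (B * (s x + s x ^ 2 / τ)) :=
          mul_le_mul (haB x (Ioo_subset_Icc_self hxm)) hle (norm_nonneg _) hB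
        nlinarith)
    rw [intervalIntegral.integral_sub ((hs.add is2).const_mul _) (iD.const_mul _),
      intervalIntegral.integral_const_mul, intervalIntegral.integral_const_mul,
      intervalIntegral.integral_add hs is2, intervalIntegral.integral_div, ← hN₁, ← hN₂, ← hI] at h
    have h1 : ‖a π‖ ^ 2 ≤ B ^ 2 :=
      pow_le_pow_left₀ (norm_nonneg _) (haB π (right_mem_Icc.mpr pi_pos.le)) 2
    have h2 : N₂ / τ ≤ N₂ := div_le_self hN₂0 hk
    have h3 : B ^ 2 * (N₂ / τ) ≤ B ^ 2 * N₂ := by gcongr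
    have h4 := sq_nonneg ‖a 0‖
    rw [hX]
    nlinarith
  have hIr : I ≤ X / √τ := by
    rw [le_div_iff₀ hr0]
    nlinarith
  have hJr : J ≤ (X + N₂) / √τ := by
    -- Young's inequality with weight `√τ` balances `∫ ‖a‖² = O(1/τ)` against `∫ s²`.
    have h : J ≤ ∫ x in (0 : ℝ)..π, (√τ * ‖a x‖ ^ 2 + s x ^ 2 / √τ) := by
      refine intervalIntegral.integral_mono_on pi_pos.le ias
        ((iD.const_mul _).add (hs2.div_const _)) fun x _ => ?_
      have h1 := sq_nonneg (√τ * ‖a x‖ - s x)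
      have h2 := mul_nonneg hr0.le (mul_nonneg (hs0 x) (norm_nonneg (a x)))
      rw [← sub_nonneg]
      have : √τ * ‖a x‖ ^ 2 + s x ^ 2 / √τ - s x * ‖a x‖
          = ((√τ * ‖a x‖ - s x) ^ 2 + √τ * (s x * ‖a x‖)) / √τ := by
        field_simp
        ring
      rw [this]
      positivity
    rw [intervalIntegral.integral_add (iD.const_mul _) (hs2.div_const _),
      intervalIntegral.integral_const_mul, intervalIntegral.integral_div, ← hI, ← hN₂] at h
    refine h.trans ?_
    rw [add_div]
    gcongr
    rw [le_div_iff₀ hr0]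
    nlinarith
  have hN₂r : N₂ / τ ≤ N₂ / √τ := by
    rw [div_eq_mul_one_div, div_eq_mul_one_div N₂]
    gcongr
  have hsplit : ∀ p q : ℝ, 0 ≤ q → p / √τ ≤ (p + q) / √τ := fun p q hq => by
    gcongr; linarith
  constructor
  · have h := (((AbsolutelyContinuousOnInterval.of_contDiff
      (f := fun x : ℝ => π - x) (by fun_prop) 0 π).fun_mul hD).fun_neg).sub_le_integral pi_pos.le
      (g := fun x => ‖a x‖ ^ 2 + 2 * π * B * (s x * ‖a x‖ + B * (s x ^ 2 / τ)))
      (iD.add ((ias.add (is2.const_mul B)).const_mul _)) (by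
        filter_upwards [had] with x hx hxm
        obtain ⟨h, hd, hle⟩ := hx hxm
        refine ⟨_, (((hasDerivAt_id x).const_sub π).fun_mul hd.norm_sq).fun_neg, ?_⟩
        rw [inner_add_right, hinner]
        have h1 := (abs_le.mp (abs_real_inner_le_norm (a x) h)).1
        have haBx := haB x (Ioo_subset_Icc_self hxm)
        have h2 : ‖a x‖ * ‖h‖ ≤ ‖a x‖ * (B * (s x + s x ^ 2 / τ)) := by gcongr
        have h3 : ‖a x‖ * (B * (s x ^ 2 / τ)) ≤ B * (B * (s x ^ 2 / τ)) := by
          gcongr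
        have h4 : -inner ℝ (a x) h ≤ B * (s x * ‖a x‖ + B * (s x ^ 2 / τ)) := by nlinarith
        have h5 : 0 ≤ B * (s x * ‖a x‖ + B * (s x ^ 2 / τ)) := by
          have := hs0 x
          positivity
        have h6 : 0 ≤ π - x := by linarith [hxm.2]
        have h7 : π - x ≤ π := by linarith [hxm.1]
        have h8 := mul_le_mul_of_nonneg_left h4 h6
        have h9 := mul_le_mul_of_nonneg_right h7 h5
        have h10 : 0 ≤ (π - x) * (τ * ‖a x‖ ^ 2) := by positivity
        simp only [id]
        nlinarith)
    rw [intervalIntegral.integral_add iD ((ias.add (is2.const_mul B)).const_mul _),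
      intervalIntegral.integral_const_mul, intervalIntegral.integral_add ias (is2.const_mul B),
      intervalIntegral.integral_const_mul, intervalIntegral.integral_div, ← hI, ← hJ, ← hN₂] at h
    simp only [sub_self, zero_mul, sub_zero, neg_zero, zero_sub, neg_neg] at h
    refine le_trans ?_ (hsplit _ _ (by positivity))
    have hpi : 1 ≤ π := by linarith [Real.pi_gt_three]
    have h1 : I ≤ π * (X / √τ) := hIr.trans (le_mul_of_one_le_left (by positivity) hpi)
    have h2 : B * J ≤ B * ((X + N₂) / √τ) := by gcongr
    have h3 : B ^ 2 * (N₂ / τ) ≤ B ^ 2 * (N₂ / √τ) := by gcongr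
    have h4 : π * ‖a 0‖ ^ 2 ≤
        π * (X / √τ + 2 * (B * ((X + N₂) / √τ)) + 2 * (B ^ 2 * (N₂ / √τ))) := by
      nlinarith
    have h5 := le_of_mul_le_mul_left h4 pi_pos
    refine h5.trans (le_of_eq ?_)
    ring
  · have h := hb.norm_sub_le_integral pi_pos.le (ias.add (is2.const_mul B)) hbd
    rw [intervalIntegral.integral_add ias (is2.const_mul B), intervalIntegral.integral_const_mul,
      intervalIntegral.integral_div, ← hJ, ← hN₂] at h
    have h3 : B * (N₂ / τ) ≤ B * (N₂ / √τ) := by gcongr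
    calc ‖b π - b 0‖ ≤ (X + N₂) / √τ + B * (N₂ / √τ) := by linarith
      _ = (X + N₂ + B * N₂) / √τ := by ring
      _ ≤ _ := by rw [add_comm (X + _ + _)]; exact hsplit _ _ (by positivity)

/-- A solution at `lam = -k²` that at `π` is not too close to the decaying direction is, at `0`,
close to a multiple of the solution `exp (k (π - x))` of the unperturbed equation. -/
theorem exists_terminal_asymptotics {σ : ℝ → ℂ} (hσ : MemLp σ 2 (volume.restrict (Ioo 0 π)))
    (M : ℝ) {ε : ℝ} (hε : 0 < ε) :
    ∃ R, ∀ k : ℂ, R ≤ k.re → ∀ y y₁ : ℝ → ℂ, IsSLSolution σ (-k ^ 2) y y₁ →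
      k * y π - y₁ π ≠ 0 → ‖k * y π + y₁ π‖ ^ 2 + ‖k * y π - y₁ π‖ ^ 2 ≤ M * ‖k * y π - y₁ π‖ ^ 2 →
      ‖Complex.exp (-(k * π)) * (k * y 0 - y₁ 0) - (k * y π - y₁ π)‖ ≤ ε * ‖k * y π - y₁ π‖ ∧
      ‖Complex.exp (-(k * π)) * (k * y 0 + y₁ 0)‖ ≤ ε * ‖k * y π - y₁ π‖ := by
  obtain ⟨h1, h2, h3⟩ := intervalIntegrable_of_memLp hσ
  obtain ⟨K, hK⟩ := exists_bound_of_dichotomy (s := fun t => ‖σ t‖) (fun t => norm_nonneg _)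
    h1.norm h3 (Real.sqrt_nonneg (M * Real.exp (growthConst σ)))
  set B := √(M * Real.exp (growthConst σ)) with hB
  have hlim : Tendsto (fun τ : ℝ => K / √τ) atTop (𝓝 0) :=
    tendsto_const_nhds.div_atTop Real.tendsto_sqrt_atTop
  obtain ⟨R, hR⟩ := eventually_atTop.mp
    (hlim.eventually (gt_mem_nhds (show 0 < min ε (ε ^ 2) by positivity)))
  refine ⟨max R 1, fun k hk y y₁ hy hw hM => ?_⟩
  have hk1 : 1 ≤ k.re := (le_max_right _ _).trans hk
  have hkn : 1 ≤ ‖k‖ := hk1.trans (Complex.re_le_norm k)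
  have hk0 : k ≠ 0 := norm_pos_iff.mp (by linarith)
  have hKε := hR k.re ((le_max_left _ _).trans hk)
  set w := k * y π - y₁ π with hwdef
  have hw0 : 0 < ‖w‖ := norm_pos_iff.mpr hw
  let e : ℝ → ℂ := fun x => Complex.exp (k * (x - π)) / w
  have he : ContDiff ℝ 1 e := by
    have : ContDiff ℝ 1 (fun x : ℝ => (x : ℂ)) := Complex.ofRealCLM.contDiff
    fun_prop
  have hed : ∀ x : ℝ, HasDerivAt e (k * e x) x := by
    intro x
    have h : HasDerivAt (fun x : ℝ => k * ((x : ℂ) - π)) (k * 1) x :=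
      ((hasDerivAt_id x).ofReal_comp.sub_const _).const_mul k
    refine (h.cexp.div_const w).congr_deriv ?_
    simp only [e]; ring
  have hen : ∀ x, ‖e x‖ = Real.exp (k.re * (x - π)) / ‖w‖ := by
    intro x
    simp only [e, norm_div, Complex.norm_exp]
    congr 2
    simp
  have heac := AbsolutelyContinuousOnInterval.of_contDiff he 0 π
  have hu : AbsolutelyContinuousOnInterval (fun x => k * y x + y₁ x) 0 π :=
    (hy.ac.const_smul k).fun_add hy.ac_quasi
  have hv : AbsolutelyContinuousOnInterval (fun x => k * y x - y₁ x) 0 π :=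
    (hy.ac.const_smul k).fun_sub hy.ac_quasi
  have hbound : ∀ x ∈ Icc (0 : ℝ) π,
      ‖e x * (k * y x + y₁ x)‖ ^ 2 + ‖e x * (k * y x - y₁ x)‖ ^ 2 ≤ B ^ 2 := by
    intro x hx
    have h := hy.energy_le_growthConst hσ hkn (by linarith) (right_mem_Icc.mpr pi_pos.le) hx
    have hMnn : 0 ≤ M := by
      by_contra hneg
      push Not at hneg
      nlinarith [sq_nonneg ‖k * y π + y₁ π‖, sq_nonneg ‖w‖, mul_pos hw0 hw0]
    rw [hB, Real.sq_sqrt (by positivity), norm_mul, norm_mul, mul_pow, mul_pow, ← mul_add, hen,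
      div_pow, ← Real.exp_nat_mul]
    have h' := h.trans (mul_le_mul_of_nonneg_right hM (Real.exp_pos _).le)
    rw [abs_of_nonpos (by linarith [hx.2]), Real.exp_add] at h'
    rw [div_mul_eq_mul_div, div_le_iff₀ (by positivity)]
    refine (mul_le_mul_of_nonneg_left h' (Real.exp_pos _).le).trans (le_of_eq ?_)
    have : Real.exp (((2 : ℕ) : ℝ) * (k.re * (x - π))) * Real.exp (2 * k.re * -(x - π)) = 1 := by
      rw [← Real.exp_add]
      convert Real.exp_zero using 2
      push_cast; ring
    linear_combination (M * ‖w‖ ^ 2 * Real.exp (growthConst σ)) * this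
  have hB0 : 0 ≤ B := Real.sqrt_nonneg _
  have hau : ∀ x ∈ Icc (0 : ℝ) π, ‖e x * (k * y x + y₁ x)‖ ≤ B := fun x hx =>
    abs_le_of_sq_le_sq' (by nlinarith [hbound x hx, sq_nonneg ‖e x * (k * y x - y₁ x)‖]) hB0 |>.2
  have hbv : ∀ x ∈ Icc (0 : ℝ) π, ‖e x * (k * y x - y₁ x)‖ ≤ B := fun x hx =>
    abs_le_of_sq_le_sq' (by nlinarith [hbound x hx, sq_nonneg ‖e x * (k * y x + y₁ x)‖]) hB0 |>.2
  have hder := hy.hasDerivAt_add_sub hk0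
  have hq : ∀ x, ‖(σ x ^ 2 + -k ^ 2 + k ^ 2) / (2 * k)‖ ≤ ‖σ x‖ ^ 2 / k.re / 2 := by
    intro x
    rw [show σ x ^ 2 + -k ^ 2 + k ^ 2 = σ x ^ 2 by ring, norm_div, norm_mul, norm_pow,
      RCLike.norm_ofNat, mul_comm, ← div_div]
    gcongr
    exact Complex.re_le_norm k
  obtain ⟨c1, c2⟩ := hK k hk1 (fun x => e x * (k * y x + y₁ x)) (fun x => e x * (k * y x - y₁ x))
    (heac.fun_smul hu) (heac.fun_smul hv) hau (by
      rw [ae_restrict_iff' measurableSet_Ioo] at hder ⊢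
      filter_upwards [hder] with x hx hxm
      have hd := (hed x).fun_mul (hx hxm).1
      have b1 := hau x (Ioo_subset_Icc_self hxm)
      have b2 := hbv x (Ioo_subset_Icc_self hxm)
      have hqx := hq x
      generalize (σ x ^ 2 + -k ^ 2 + k ^ 2) / (2 * k) = q at hd hqx
      refine ⟨σ x * (e x * (k * y x - y₁ x)) -
        q * (e x * (k * y x + y₁ x) + e x * (k * y x - y₁ x)), hd.congr_deriv (by ring), ?_⟩
      generalize e x * (k * y x + y₁ x) = u at *
      generalize e x * (k * y x - y₁ x) = v at *
      calc ‖σ x * v - q * (u + v)‖ ≤ ‖σ x‖ * ‖v‖ + ‖q‖ * (‖u‖ + ‖v‖) := by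
            grw [norm_sub_le, norm_mul, norm_mul, norm_add_le]
        _ ≤ ‖σ x‖ * B + ‖σ x‖ ^ 2 / k.re / 2 * (B + B) := by gcongr
        _ = _ := by ring) (by
      rw [ae_restrict_iff' measurableSet_Ioo] at hder ⊢
      filter_upwards [hder] with x hx hxm
      have hd := (hed x).fun_mul (hx hxm).2
      have b1 := hau x (Ioo_subset_Icc_self hxm)
      have b2 := hbv x (Ioo_subset_Icc_self hxm)
      have hqx := hq x
      generalize (σ x ^ 2 + -k ^ 2 + k ^ 2) / (2 * k) = q at hd hqx
      refine ⟨σ x * (e x * (k * y x + y₁ x)) +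
        q * (e x * (k * y x + y₁ x) + e x * (k * y x - y₁ x)), hd.congr_deriv (by ring), ?_⟩
      generalize e x * (k * y x + y₁ x) = u at *
      generalize e x * (k * y x - y₁ x) = v at *
      calc ‖σ x * u + q * (u + v)‖ ≤ ‖σ x‖ * ‖u‖ + ‖q‖ * (‖u‖ + ‖v‖) := by
            grw [norm_add_le, norm_mul, norm_mul, norm_add_le]
        _ ≤ ‖σ x‖ * ‖u‖ + ‖σ x‖ ^ 2 / k.re / 2 * (B + B) := by gcongr
        _ = _ := by ring)
  have e0 : e 0 = Complex.exp (-(k * π)) / w := by simp [e]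
  have eπ : e π * w = 1 := by simp [e, hw]
  simp only [e0, ← hwdef, eπ] at c1 c2
  have c1' := c1.trans (hKε.le.trans (min_le_right _ _))
  have c2' := c2.trans (hKε.le.trans (min_le_left _ _))
  constructor
  · rw [norm_sub_rev, ← div_le_iff₀ hw0, ← norm_div]
    refine le_trans (le_of_eq ?_) c2'
    congr 1
    field_simp
  · rw [← div_le_iff₀ hw0, ← norm_div, mul_div_right_comm]
    exact abs_le_of_sq_le_sq' c1' hε.le |>.2

/-! ### Dependence on the spectral parameter -/

/-- Carathéodory's form of the derivative. -/
theorem hasDerivAt_of_eq_add_mul {f g : ℂ → ℂ} {mu : ℂ} (h : ∀ z, f z = f mu + (z - mu) * g z)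
    (hg : ContinuousAt g mu) : HasDerivAt f (g mu) mu := by
  rw [hasDerivAt_iff_tendsto_slope]
  refine (hg.tendsto.mono_left nhdsWithin_le_nhds).congr' ?_
  filter_upwards [self_mem_nhdsWithin] with z hz
  have hz' : z - mu ≠ 0 := sub_ne_zero.mpr hz
  rw [slope_def_field, h z]
  field_simp
  ring

section initialSol

variable {σ : ℝ → ℂ} (hσ : MemLp σ 2 (volume.restrict (Ioo 0 π))) (a b : ℂ)

/-- Solutions with fixed initial data are bounded on `[0, π]`, locally uniformly in `lam`. -/
theorem exists_bound_initialSol (r : ℝ) :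
    ∃ B, 0 ≤ B ∧ ∀ lam : ℂ, ‖lam‖ ≤ r → ∀ x ∈ Icc 0 π, ‖(initialSol hσ a b lam).1 x‖ ≤ B := by
  obtain ⟨h1, h2, h3⟩ := intervalIntegrable_of_memLp hσ
  set G := ∫ t in (0 : ℝ)..π, (2 * ‖σ t‖ + 2 * (‖σ t‖ ^ 2 + (r + 1))) with hG
  refine ⟨√((‖a + b‖ ^ 2 + ‖a - b‖ ^ 2) * Real.exp (2 * π + G)), Real.sqrt_nonneg _, ?_⟩
  intro lam hlam x hx
  apply Real.le_sqrt_of_sq_le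
  have hy := isSLSolution_initialSol hσ a b lam
  have h := hy.energy_le hσ one_ne_zero (by simp) (left_mem_Icc.mpr pi_pos.le) hx
  rw [initialSol_fst_zero, initialSol_snd_zero] at h
  simp only [one_mul, Complex.one_re, mul_one, sub_zero, one_pow, norm_one, div_one] at h
  have hle : 2 * |x| + ∫ t in (0 : ℝ)..π, (2 * ‖σ t‖ + 2 * ‖σ t ^ 2 + lam + 1‖) ≤ 2 * π + G := by
    refine add_le_add (by rw [abs_of_nonneg hx.1]; linarith [hx.2])
      (intervalIntegral.integral_mono_on pi_pos.le ?_ ?_ fun t _ => ?_)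
    · exact (h1.norm.const_mul 2).add
        (((h2.add intervalIntegrable_const).add intervalIntegrable_const).norm.const_mul 2)
    · exact (h1.norm.const_mul 2).add ((h3.add intervalIntegrable_const).const_mul 2)
    · have : ‖σ t ^ 2 + lam + 1‖ ≤ ‖σ t‖ ^ 2 + (r + 1) := by
        grw [norm_add_le, norm_add_le, norm_pow, hlam, norm_one, add_assoc]
      linarith
  have h' := h.trans (mul_le_mul_of_nonneg_left (Real.exp_le_exp.mpr hle) (by positivity))
  generalize (initialSol hσ a b lam).1 x = Y at *
  generalize (initialSol hσ a b lam).2 x = Z at *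
  have hpar := parallelogram_law_with_norm ℝ Y Z
  nlinarith [mul_self_nonneg ‖Z‖, mul_self_nonneg ‖Y‖]

/-- Solutions with fixed initial data are entire functions of the spectral parameter. -/
theorem differentiable_initialSol {x : ℝ} (hx : x ∈ Icc 0 π) :
    Differentiable ℂ fun lam => (initialSol hσ a b lam).1 x := by
  intro mu
  set c := (initialSol hσ 1 0 mu).1 with hc
  set s := (initialSol hσ 0 1 mu).1 with hs
  let y : ℂ → ℝ → ℂ := fun lam => (initialSol hσ a b lam).1
  have hy : ∀ lam, ContinuousOn (y lam) (Icc 0 π) := fun lam =>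
    (isSLSolution_initialSol hσ a b lam).continuousOn
  have hcc : ContinuousOn c (Icc 0 π) := (isSLSolution_initialSol hσ 1 0 mu).continuousOn
  have hsc : ContinuousOn s (Icc 0 π) := (isSLSolution_initialSol hσ 0 1 mu).continuousOn
  let g : ℝ → ℂ → ℂ := fun x lam =>
    c x * (∫ t in (0 : ℝ)..x, y lam t * s t) - s x * ∫ t in (0 : ℝ)..x, y lam t * c t
  have hvar : ∀ x ∈ Icc (0 : ℝ) π, ∀ lam, y lam x = y mu x + (lam - mu) * g x lam := by
    intro x hx lam
    have key := fun lam => (isSLSolution_initialSol hσ a b lam).variation_of_constants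
      (isSLSolution_initialSol hσ 1 0 mu) (isSLSolution_initialSol hσ 0 1 mu)
      (initialSol_fst_zero hσ 1 0 mu) (initialSol_snd_zero hσ 1 0 mu)
      (initialSol_fst_zero hσ 0 1 mu) (initialSol_snd_zero hσ 0 1 mu) hx
    have e1 := key lam
    have e2 := key mu
    rw [initialSol_fst_zero, initialSol_snd_zero] at e1 e2
    simp only [sub_self, zero_mul, add_zero] at e2
    simp only [y, g]
    rw [e1, e2]
  obtain ⟨B, hB0, hB⟩ := exists_bound_initialSol hσ a b (‖mu‖ + 1)
  obtain ⟨Bc, hBc0, hBc⟩ := exists_bound_initialSol hσ 1 0 ‖mu‖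
  obtain ⟨Bs, hBs0, hBs⟩ := exists_bound_initialSol hσ 0 1 ‖mu‖
  replace hBc := hBc mu le_rfl
  replace hBs := hBs mu le_rfl
  have hint : ∀ x ∈ Icc (0 : ℝ) π, ∀ (f e : ℝ → ℂ) (N P : ℝ), 0 ≤ N → 0 ≤ P →
      (∀ t ∈ Icc (0 : ℝ) π, ‖f t‖ ≤ N) →
      (∀ t ∈ Icc (0 : ℝ) π, ‖e t‖ ≤ P) → ‖∫ t in (0 : ℝ)..x, f t * e t‖ ≤ N * P * π := by
    intro x hx f e N P hN hP hf he
    have h := intervalIntegral.norm_integral_le_of_norm_le_const (a := (0 : ℝ)) (b := x)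
      (f := fun t => f t * e t) (C := N * P) (fun t ht => by
        rw [uIoc_of_le hx.1] at ht
        have ht' : t ∈ Icc (0 : ℝ) π := ⟨ht.1.le, ht.2.trans hx.2⟩
        rw [norm_mul]
        exact mul_le_mul (hf t ht') (he t ht') (norm_nonneg _) hN)
    refine h.trans (mul_le_mul_of_nonneg_left ?_ (by positivity))
    rw [sub_zero, abs_of_nonneg hx.1]
    exact hx.2
  have hgB : ∀ x ∈ Icc (0 : ℝ) π, ∀ lam, ‖lam - mu‖ ≤ 1 →
      ‖g x lam‖ ≤ Bc * (B * Bs * π) + Bs * (B * Bc * π) := by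
    intro x hx lam hlam
    have hl : ‖lam‖ ≤ ‖mu‖ + 1 := by
      have := norm_add_le mu (lam - mu)
      rw [add_sub_cancel] at this
      linarith
    refine (norm_sub_le _ _).trans ?_
    rw [norm_mul, norm_mul]
    gcongr
    · exact hBc x hx
    · exact hint x hx _ _ _ _ hB0 hBs0 (hB lam hl) hBs
    · exact hBs x hx
    · exact hint x hx _ _ _ _ hB0 hBc0 (hB lam hl) hBc
  set N := Bc * (B * Bs * π) + Bs * (B * Bc * π) with hN
  have hN0 : 0 ≤ N := by positivity
  have hlip : ∀ lam, ‖lam - mu‖ ≤ 1 → ∀ t ∈ Icc (0 : ℝ) π,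
      ‖y lam t - y mu t‖ ≤ ‖lam - mu‖ * N := by
    intro lam hlam t ht
    rw [hvar t ht lam, add_sub_cancel_left, norm_mul]
    gcongr
    exact hgB t ht lam hlam
  have hdiff : ∀ lam, ∀ e : ℝ → ℂ, ContinuousOn e (Icc 0 π) →
      (∫ t in (0 : ℝ)..x, y lam t * e t) - ∫ t in (0 : ℝ)..x, y mu t * e t
        = ∫ t in (0 : ℝ)..x, (y lam t - y mu t) * e t := by
    intro lam e he
    have hsub : uIcc 0 x ⊆ Icc 0 π := by
      rw [uIcc_of_le hx.1]; exact Icc_subset_Icc le_rfl hx.2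
    rw [← intervalIntegral.integral_sub]
    · simp only [sub_mul]
    · exact (((hy lam).mul he).mono hsub).intervalIntegrable
    · exact (((hy mu).mul he).mono hsub).intervalIntegrable
  have hgc : ContinuousAt (g x) mu := by
    rw [ContinuousAt, tendsto_iff_norm_sub_tendsto_zero]
    have hb : ∀ᶠ lam in 𝓝 mu, ‖g x lam - g x mu‖
        ≤ ‖lam - mu‖ * (Bc * (N * Bs * π) + Bs * (N * Bc * π)) := by
      filter_upwards [Metric.closedBall_mem_nhds mu one_pos] with lam hlam
      rw [mem_closedBall_iff_norm] at hlam
      have e : g x lam - g x mu = c x * (∫ t in (0 : ℝ)..x, (y lam t - y mu t) * s t) -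
          s x * ∫ t in (0 : ℝ)..x, (y lam t - y mu t) * c t := by
        rw [← hdiff lam s hsc, ← hdiff lam c hcc]
        simp only [g]; ring
      rw [e]
      have hNl : 0 ≤ ‖lam - mu‖ * N := by positivity
      have i1 := hint x hx _ _ _ _ hNl hBs0 (hlip lam hlam) hBs
      have i2 := hint x hx _ _ _ _ hNl hBc0 (hlip lam hlam) hBc
      calc _ ≤ ‖c x‖ * ‖∫ t in (0 : ℝ)..x, (y lam t - y mu t) * s t‖ +
            ‖s x‖ * ‖∫ t in (0 : ℝ)..x, (y lam t - y mu t) * c t‖ := by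
            grw [norm_sub_le, norm_mul, norm_mul]
        _ ≤ Bc * (‖lam - mu‖ * N * Bs * π) + Bs * (‖lam - mu‖ * N * Bc * π) := by
            gcongr
            · exact hBc x hx
            · exact hBs x hx
        _ = _ := by ring
    refine squeeze_zero' (Eventually.of_forall fun _ => norm_nonneg _) hb ?_
    have : Tendsto (fun lam : ℂ => ‖lam - mu‖ * (Bc * (N * Bs * π) + Bs * (N * Bc * π))) (𝓝 mu)
        (𝓝 (‖mu - mu‖ * (Bc * (N * Bs * π) + Bs * (N * Bc * π)))) := by
      apply Continuous.tendsto
      fun_prop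
    simpa using this
  exact (hasDerivAt_of_eq_add_mul (fun lam => hvar x hx lam) hgc).differentiableAt

/-- Growth in `lam = -k²` of the solutions with fixed initial data. -/
theorem norm_initialSol_le {k : ℂ} (hk : 1 ≤ ‖k‖) (hkre : 0 ≤ k.re) {x : ℝ} (hx : x ∈ Icc 0 π) :
    ‖(initialSol hσ a b (-k ^ 2)).1 x‖
      ≤ (‖a‖ + ‖b‖ / ‖k‖) * Real.exp (growthConst σ / 2) * Real.exp (k.re * x) := by
  have hk0 : 0 < ‖k‖ := by linarith
  have h := (isSLSolution_initialSol hσ a b (-k ^ 2)).energy_le_growthConst hσ hk hkre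
    (left_mem_Icc.mpr pi_pos.le) hx
  rw [initialSol_fst_zero, initialSol_snd_zero, sub_zero, abs_of_nonneg hx.1] at h
  refine abs_le_of_sq_le_sq' ?_ (by positivity) |>.2
  have e1 : Real.exp (2 * k.re * x + growthConst σ)
      = (Real.exp (growthConst σ / 2) * Real.exp (k.re * x)) ^ 2 := by
    rw [← Real.exp_add, ← Real.exp_nat_mul]
    congr 1
    push_cast; ring
  rw [e1] at h
  rw [mul_assoc, mul_pow]
  have hP := sq_nonneg (Real.exp (growthConst σ / 2) * Real.exp (k.re * x))
  generalize (Real.exp (growthConst σ / 2) * Real.exp (k.re * x)) ^ 2 = P at h hP ⊢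
  generalize (initialSol hσ a b (-k ^ 2)).1 x = Y at *
  generalize (initialSol hσ a b (-k ^ 2)).2 x = Z at *
  have p1 := parallelogram_law_with_norm ℝ (k * Y) Z
  have p2 := parallelogram_law_with_norm ℝ (k * a) b
  have h' : ‖k‖ ^ 2 * ‖Y‖ ^ 2 ≤ (‖k‖ * ‖a‖ + ‖b‖) ^ 2 * P := by
    simp only [norm_mul] at p1 p2
    have h2 : ‖k * a + b‖ ^ 2 + ‖k * a - b‖ ^ 2 ≤ 2 * (‖k‖ * ‖a‖ + ‖b‖) ^ 2 := by
      have : 0 ≤ ‖k‖ * ‖a‖ * ‖b‖ := by positivity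
      nlinarith
    have h3 := mul_le_mul_of_nonneg_right h2 hP
    nlinarith [sq_nonneg ‖Z‖]
  have e2 : (‖a‖ + ‖b‖ / ‖k‖) ^ 2 * P = (‖k‖ * ‖a‖ + ‖b‖) ^ 2 * P / ‖k‖ ^ 2 := by
    field_simp
  rw [e2, le_div_iff₀ (by positivity)]
  linarith

end initialSol

theorem exists_sq_eq_re_nonneg (z : ℂ) : ∃ w : ℂ, w ^ 2 = z ∧ 0 ≤ w.re := by
  obtain ⟨w, hw⟩ := IsAlgClosed.exists_pow_nat_eq z two_pos
  rcases le_total 0 w.re with h | h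
  · exact ⟨w, hw, h⟩
  · exact ⟨-w, by rw [neg_sq, hw], by simpa using h⟩

theorem exists_sq_eq_of_im_nonneg {z : ℂ} (hz : 0 ≤ z.im) :
    ∃ w : ℂ, w ^ 2 = z ∧ 0 ≤ w.re ∧ 0 ≤ w.im := by
  obtain ⟨w, hw, hre⟩ := exists_sq_eq_re_nonneg z
  rcases le_or_gt 0 w.im with h | h
  · exact ⟨w, hw, hre, h⟩
  · -- Here `z.im = 2 w.re w.im` forces `w.re = 0`, and `-w` serves.
    rw [← hw, sq, Complex.mul_im] at hz
    have : w.re = 0 := by nlinarith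
    exact ⟨-w, by rw [neg_sq, hw], by simp [this], by simpa using h.le⟩

/-- An entire function of order `1/2` and finite type which, at `-k²`, is `O(1/‖k‖)` for `Re k`
large vanishes identically. The decay covers the imaginary axis up to a compact part, so the
Phragmén–Lindelöf principle bounds the function in both half-planes, and Liouville's theorem
applies. -/
theorem eq_zero_of_decay_of_growth {f : ℂ → ℂ} (hf : Differentiable ℂ f) {A B K R : ℝ}
    (hgrowth : ∀ k : ℂ, 0 ≤ k.re → 1 ≤ ‖k‖ → ‖f (-k ^ 2)‖ ≤ A * Real.exp (B * ‖k‖))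
    (hdecay : ∀ k : ℂ, R ≤ k.re → ‖f (-k ^ 2)‖ ≤ K / ‖k‖) (z : ℂ) : f z = 0 := by
  have hK : 0 ≤ K := by
    have h := (norm_nonneg _).trans (hdecay (max R 1 : ℝ) (by simp))
    by_contra hneg
    have hpos : 0 < ‖((max R 1 : ℝ) : ℂ)‖ := by
      rw [Complex.norm_real, Real.norm_eq_abs]
      exact abs_pos.mpr (by positivity)
    exact absurd h (not_le.mpr (div_neg_of_neg_of_pos (not_le.mp hneg) hpos))
  have haxis : ∀ ζ : ℂ, ζ ^ 2 = -1 → ζ.re = 0 → ∃ N, ∀ x : ℝ, 0 ≤ x → ‖f (ζ * x ^ 2)‖ ≤ N := by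
    intro ζ hζ hζre
    obtain ⟨N, hN⟩ := (isCompact_Icc (a := (0 : ℝ)) (b := √2 * max R 1)).exists_bound_of_continuousOn
      (f := fun x : ℝ => f (ζ * x ^ 2)) (by
        have := hf.continuous
        fun_prop)
    refine ⟨max N K, fun x hx => ?_⟩
    rcases le_total x (√2 * max R 1) with h | h
    · exact (hN x ⟨hx, h⟩).trans (le_max_left _ _)
    · have h2 : (0 : ℝ) < √2 := by positivity
      have hsq : ((√2 : ℝ) : ℂ) ^ 2 = 2 := by
        rw [← Complex.ofReal_pow, Real.sq_sqrt (by norm_num)]; norm_num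
      have hne : ((√2 : ℝ) : ℂ) ≠ 0 := by exact_mod_cast h2.ne'
      have hk : -(((x / √2 : ℝ) : ℂ) * (1 - ζ)) ^ 2 = ζ * x ^ 2 := by
        push_cast
        rw [mul_pow, div_pow, hsq]
        linear_combination (-(x : ℂ) ^ 2 / 2) * hζ
      have hre : (((x / √2 : ℝ) : ℂ) * (1 - ζ)).re = x / √2 := by
        rw [Complex.re_ofReal_mul]; simp [hζre]
      have hxR : max R 1 ≤ x / √2 := by rw [le_div_iff₀ h2]; linarith
      have h3 := hdecay (((x / √2 : ℝ) : ℂ) * (1 - ζ)) (by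
        rw [hre]; exact (le_max_left _ _).trans hxR)
      rw [hk] at h3
      refine h3.trans ((div_le_self hK ?_).trans (le_max_right _ _))
      have h4 := Complex.re_le_norm (((x / √2 : ℝ) : ℂ) * (1 - ζ))
      rw [hre] at h4
      exact ((le_max_right _ _).trans hxR).trans h4
  obtain ⟨N₁, hN₁⟩ := haxis Complex.I (by simp) (by simp)
  obtain ⟨N₂, hN₂⟩ := haxis (-Complex.I) (by simp) (by simp)
  have hquad : ∀ ζ : ℂ, ‖ζ‖ = 1 → (∀ x : ℝ, 0 ≤ x → ‖f (ζ * x ^ 2)‖ ≤ max N₁ N₂) →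
      (∀ x : ℝ, 0 ≤ x → ‖f (-ζ * x ^ 2)‖ ≤ max N₁ N₂) → ∀ w : ℂ, 0 ≤ w.re → 0 ≤ w.im →
      ‖f (ζ * w ^ 2)‖ ≤ max N₁ N₂ := by
    intro ζ hζ h1 h2 w hre him
    refine PhragmenLindelof.quadrant_I (f := fun w => f (ζ * w ^ 2)) ?_ ⟨1, by norm_num, B, ?_⟩
      h1 (fun x hx => ?_) hre him
    · exact (hf.comp (by fun_prop)).diffContOnCl
    · refine Asymptotics.IsBigO.of_bound A ?_
      refine Filter.Eventually.filter_mono inf_le_left ?_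
      filter_upwards [tendsto_norm_cobounded_atTop.eventually (eventually_ge_atTop (1 : ℝ))] with u hu
      obtain ⟨k, hk, hkre⟩ := exists_sq_eq_re_nonneg (-(ζ * u ^ 2))
      have hnorm : ‖k‖ = ‖u‖ := by
        have := congrArg norm hk
        rw [norm_pow, norm_neg, norm_mul, hζ, one_mul, norm_pow] at this
        exact (pow_left_inj₀ (norm_nonneg _) (norm_nonneg _) two_ne_zero).mp this
      have h := hgrowth k hkre (by rw [hnorm]; exact hu)
      rw [hk, neg_neg, hnorm] at h
      rw [Real.rpow_one, Real.norm_eq_abs, Real.abs_exp]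
      exact h
    · have := h2 x hx
      rwa [show ζ * ((x : ℂ) * Complex.I) ^ 2 = -ζ * x ^ 2 by
        rw [mul_pow, Complex.I_sq]; ring]
  have hbdd : ∀ z, ‖f z‖ ≤ max N₁ N₂ := by
    intro z
    rcases le_total 0 z.re with h | h
    · obtain ⟨w, hw, hre, him⟩ := exists_sq_eq_of_im_nonneg (z := Complex.I * z) (by simpa using h)
      have := hquad (-Complex.I) (by simp) (fun x hx => (hN₂ x hx).trans (le_max_right _ _))
        (fun x hx => by rw [neg_neg]; exact (hN₁ x hx).trans (le_max_left _ _)) w hre him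
      rwa [hw, show -Complex.I * (Complex.I * z) = z by
        linear_combination -z * Complex.I_mul_I] at this
    · obtain ⟨w, hw, hre, him⟩ := exists_sq_eq_of_im_nonneg (z := -(Complex.I * z)) (by simpa using h)
      have := hquad Complex.I (by simp) (fun x hx => (hN₁ x hx).trans (le_max_left _ _))
        (fun x hx => (hN₂ x hx).trans (le_max_right _ _)) w hre him
      rwa [hw, show Complex.I * -(Complex.I * z) = z by
        linear_combination -z * Complex.I_mul_I] at this
  have hconst : ∀ w, f w = f z := fun w =>
    hf.apply_eq_apply_of_bounded
      (isBounded_iff_forall_norm_le.mpr ⟨_, by rintro _ ⟨u, rfl⟩; exact hbdd u⟩) w z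
  have hlim : Tendsto (fun t : ℝ => K / t) atTop (𝓝 0) := tendsto_const_nhds.div_atTop tendsto_id
  refine norm_le_zero_iff.mp (ge_of_tendsto hlim ?_)
  filter_upwards [eventually_ge_atTop R, eventually_gt_atTop 0] with t ht ht0
  have h := hdecay (t : ℂ) (by simpa using ht)
  rwa [hconst, Complex.norm_real, Real.norm_eq_abs, abs_of_pos ht0] at h

/-! ### The Weyl solution -/

/-- `k p(-k²)` and `q(-k²)` have opposite parity in `k`, so they cannot cancel to leading order. -/
theorem exists_bound_of_parity {p q : ℂ[X]} (h : p ≠ 0 ∨ q ≠ 0) :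
    ∃ M R : ℝ, 0 ≤ M ∧ ∀ k : ℂ, R ≤ ‖k‖ →
      k * p.eval (-k ^ 2) + q.eval (-k ^ 2) ≠ 0 ∧
      ‖k * p.eval (-k ^ 2) - q.eval (-k ^ 2)‖ ≤ M * ‖k * p.eval (-k ^ 2) + q.eval (-k ^ 2)‖ := by
  set T : ℂ[X] := X * p.comp (-X ^ 2) + q.comp (-X ^ 2) with hT
  have hTe : ∀ k, T.eval k = k * p.eval (-k ^ 2) + q.eval (-k ^ 2) := by
    intro k; simp [hT]
  have hT0 : T ≠ 0 := by
    intro h0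
    have e1 : ∀ k : ℂ, k * p.eval (-k ^ 2) + q.eval (-k ^ 2) = 0 := fun k => by
      rw [← hTe, h0, eval_zero]
    have e2 : ∀ k : ℂ, q.eval (-k ^ 2) = 0 := fun k => by
      have h1 := e1 k
      have h2 := e1 (-k)
      rw [neg_sq] at h2
      linear_combination (h1 + h2) / 2
    have hq : q = 0 := Polynomial.funext fun z => by
      obtain ⟨k, hk, -⟩ := exists_sq_eq_re_nonneg (-z)
      have := e2 k
      rw [hk, neg_neg] at this
      rw [this, eval_zero]
    have hp : X * p = 0 := Polynomial.funext fun z => by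
      obtain ⟨k, hk, -⟩ := exists_sq_eq_re_nonneg (-z)
      have h1 := e1 k
      rw [e2 k, add_zero, hk, neg_neg] at h1
      have hz : z = -k ^ 2 := by rw [hk, neg_neg]
      rw [eval_mul, eval_X, eval_zero]
      linear_combination (-k) * h1 + hz * p.eval z
    exact h.elim (fun h => h (by simpa using hp)) (fun h => h hq)
  have hdeg : (T.comp (-X)).degree ≤ T.degree := by
    rw [degree_eq_natDegree hT0]
    refine degree_le_natDegree.trans ?_
    rw [natDegree_comp, natDegree_neg, natDegree_X, mul_one]
  obtain ⟨M, hM⟩ := (isBigO_cobounded_of_degree_le hdeg).bound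
  have hroot : ∀ᶠ k in Bornology.cobounded ℂ, ¬T.IsRoot k :=
    (eventually_cofinite_not_isRoot hT0).filter_mono (Bornology.le_cofinite ℂ)
  obtain ⟨R, -, hR⟩ := (hasBasis_cobounded_norm (E := ℂ)).eventually_iff.mp (hM.and hroot)
  refine ⟨max M 0, R, le_max_right _ _, fun k hk => ?_⟩
  obtain ⟨h1, h2⟩ := hR hk
  rw [IsRoot, hTe] at h2
  rw [eval_comp, hTe, hTe] at h1
  refine ⟨h2, le_trans (le_of_eq ?_) (h1.trans ?_)⟩
  · rw [← norm_neg]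
    congr 1
    simp only [eval_neg, eval_X, neg_sq]
    ring
  · gcongr
    exact le_max_left _ _

namespace PolySLProblem

/-- For `Re k` large, neither `ψ(0, -k²)` nor the denominator of the Weyl function vanishes, and
the Weyl solution `ψ(x, -k²) / ψ(0, -k²)` decays like `exp (-Re k x)`. -/
theorem exists_psi_bound (L : PolySLProblem) (hp : L.p₁ ≠ 0) :
    ∃ R C : ℝ, 0 ≤ C ∧ ∀ k : ℂ, R ≤ k.re → L.psi 0 (-k ^ 2) ≠ 0 ∧ L.weylDenom (-k ^ 2) ≠ 0 ∧
      ∀ x ∈ Icc 0 π,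
        ‖L.psi x (-k ^ 2)‖ ≤ C * Real.exp (-(k.re * x)) * ‖L.psi 0 (-k ^ 2)‖ := by
  have hr : L.r₁ ≠ 0 ∨ L.r₂ ≠ 0 := L.coprime_r.ne_zero_or_ne_zero
  obtain ⟨M, R₁, hM0, hM⟩ := exists_bound_of_parity hr
  obtain ⟨P, R₂, hP0, hP⟩ := exists_bound_of_parity (q := L.p₂) (Or.inl hp)
  set ε : ℝ := 1 / (4 * (1 + P)) with hε
  have hε0 : 0 < ε := by positivity
  have hεP : ε * (1 + P) = 1 / 4 := by rw [hε]; field_simp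
  obtain ⟨R₃, hR₃⟩ := exists_terminal_asymptotics L.memLp (M ^ 2 + 1) hε0
  refine ⟨max (max R₁ R₂) (max R₃ 1),
    √(16 * (M ^ 2 + 1) * Real.exp (growthConst L.σ)), Real.sqrt_nonneg _, fun k hk => ?_⟩
  have hk1 : 1 ≤ k.re := (le_max_right _ _).trans ((le_max_right _ _).trans hk)
  have hkn : k.re ≤ ‖k‖ := Complex.re_le_norm k
  obtain ⟨hv0, huv⟩ := hM k
    (((le_max_left _ _).trans ((le_max_left _ _).trans hk)).trans hkn)
  obtain ⟨hT0, hTT⟩ := hP k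
    (((le_max_right _ _).trans ((le_max_left _ _).trans hk)).trans hkn)
  obtain ⟨hψ, hψπ, hψπ₁⟩ := L.psi_spec (-k ^ 2)
  have hw : k * L.psi π (-k ^ 2) - L.psiQuasi π (-k ^ 2)
      = k * L.r₁.eval (-k ^ 2) + L.r₂.eval (-k ^ 2) := by rw [hψπ, hψπ₁]; ring
  have hu : k * L.psi π (-k ^ 2) + L.psiQuasi π (-k ^ 2)
      = k * L.r₁.eval (-k ^ 2) - L.r₂.eval (-k ^ 2) := by rw [hψπ, hψπ₁]; ring
  have hEπ : ‖k * L.psi π (-k ^ 2) + L.psiQuasi π (-k ^ 2)‖ ^ 2 +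
      ‖k * L.psi π (-k ^ 2) - L.psiQuasi π (-k ^ 2)‖ ^ 2
      ≤ (M ^ 2 + 1) * ‖k * L.psi π (-k ^ 2) - L.psiQuasi π (-k ^ 2)‖ ^ 2 := by
    rw [hu, hw]
    have := pow_le_pow_left₀ (norm_nonneg _) huv 2
    linarith [mul_pow M ‖k * L.r₁.eval (-k ^ 2) + L.r₂.eval (-k ^ 2)‖ 2]
  have hw0 : k * L.psi π (-k ^ 2) - L.psiQuasi π (-k ^ 2) ≠ 0 := by rw [hw]; exact hv0
  obtain ⟨a1, a2⟩ := hR₃ k ((le_max_left _ _).trans ((le_max_right _ _).trans hk)) _ _ hψ hw0 hEπ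
  have henergy := fun x hx => hψ.energy_le_growthConst L.memLp (hk1.trans hkn) (by linarith)
    (right_mem_Icc.mpr pi_pos.le) (x := x) hx
  set w := k * L.psi π (-k ^ 2) - L.psiQuasi π (-k ^ 2) with hwdef
  set e := Complex.exp (-(k * π)) with he
  have hen : ‖e‖ = Real.exp (-(k.re * π)) := by
    rw [he, Complex.norm_exp]; congr 1; simp
  have hwpos : 0 < ‖w‖ := norm_pos_iff.mpr hw0
  have hεle : ε ≤ 1 / 4 := by nlinarith
  have hk0 : 0 < ‖k‖ := by linarith
  have hψ0 : ‖w‖ / 2 ≤ 2 * ‖k‖ * ‖L.psi 0 (-k ^ 2)‖ * Real.exp (-(k.re * π)) := by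
    have e1 : w = e * (2 * k * L.psi 0 (-k ^ 2)) -
        ((e * (k * L.psi 0 (-k ^ 2) - L.psiQuasi 0 (-k ^ 2)) - w) +
          e * (k * L.psi 0 (-k ^ 2) + L.psiQuasi 0 (-k ^ 2))) := by ring
    have e2 : ‖w‖ ≤ ‖e * (2 * k * L.psi 0 (-k ^ 2))‖ + (ε * ‖w‖ + ε * ‖w‖) := by
      conv_lhs => rw [e1]
      grw [norm_sub_le, norm_add_le, a1, a2]
    rw [norm_mul, norm_mul, norm_mul, hen, RCLike.norm_ofNat] at e2
    nlinarith
  refine ⟨?_, ?_, ?_⟩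
  · intro h0
    rw [h0, norm_zero, mul_zero, zero_mul] at hψ0
    linarith
  · intro h0
    set T := k * L.p₁.eval (-k ^ 2) + L.p₂.eval (-k ^ 2) with hT
    have hTpos : 0 < ‖T‖ := norm_pos_iff.mpr hT0
    have e1 : w * T = e * (k * L.psi 0 (-k ^ 2) + L.psiQuasi 0 (-k ^ 2)) *
        (k * L.p₁.eval (-k ^ 2) - L.p₂.eval (-k ^ 2)) -
        (e * (k * L.psi 0 (-k ^ 2) - L.psiQuasi 0 (-k ^ 2)) - w) * T := by
      unfold weylDenom at h0
      rw [hT]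
      linear_combination (-2 * k * e) * h0
    have e2 : ‖w‖ * ‖T‖ ≤ ε * ‖w‖ * (P * ‖T‖) + ε * ‖w‖ * ‖T‖ := by
      rw [← norm_mul, e1]
      refine (norm_sub_le _ _).trans ?_
      rw [norm_mul _ T, norm_mul _ (k * eval (-k ^ 2) L.p₁ - eval (-k ^ 2) L.p₂)]
      gcongr
    have e3 : 0 < ‖w‖ * ‖T‖ := by positivity
    nlinarith
  · intro x hx
    have h := henergy x hx
    refine abs_le_of_sq_le_sq' ?_ (by positivity) |>.2
    have par := parallelogram_law_with_norm ℝ (k * L.psi x (-k ^ 2)) (L.psiQuasi x (-k ^ 2))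
    rw [norm_mul k] at par
    have h1 : ‖k‖ ^ 2 * ‖L.psi x (-k ^ 2)‖ ^ 2 ≤ (M ^ 2 + 1) * ‖w‖ ^ 2 *
        Real.exp (2 * k.re * |x - π| + growthConst L.σ) := by
      have := mul_le_mul_of_nonneg_right hEπ
        (Real.exp_pos (2 * k.re * |x - π| + growthConst L.σ)).le
      nlinarith [sq_nonneg ‖L.psiQuasi x (-k ^ 2)‖,
        sq_nonneg (‖k‖ * ‖L.psi x (-k ^ 2)‖)]
    have h2 : ‖w‖ ^ 2 ≤ 16 * ‖k‖ ^ 2 * ‖L.psi 0 (-k ^ 2)‖ ^ 2 * Real.exp (-(k.re * π)) ^ 2 := by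
      have := pow_le_pow_left₀ (by positivity) hψ0 2
      nlinarith
    rw [mul_pow, mul_pow, Real.sq_sqrt (by positivity)]
    have h3 : Real.exp (-(k.re * π)) ^ 2 * Real.exp (2 * k.re * |x - π| + growthConst L.σ)
        = Real.exp (growthConst L.σ) * Real.exp (-(k.re * x)) ^ 2 := by
      rw [← Real.exp_nat_mul, ← Real.exp_nat_mul, ← Real.exp_add, ← Real.exp_add,
        abs_of_nonpos (by linarith [hx.2])]
      congr 1
      push_cast; ring
    refine le_of_mul_le_mul_left (h1.trans ?_) (by positivity : 0 < ‖k‖ ^ 2)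
    calc (M ^ 2 + 1) * ‖w‖ ^ 2 * Real.exp (2 * k.re * |x - π| + growthConst L.σ)
        ≤ (M ^ 2 + 1) * (16 * ‖k‖ ^ 2 * ‖L.psi 0 (-k ^ 2)‖ ^ 2 * Real.exp (-(k.re * π)) ^ 2) *
          Real.exp (2 * k.re * |x - π| + growthConst L.σ) := by gcongr
      _ = _ := by linear_combination (M ^ 2 + 1) * (16 * ‖k‖ ^ 2 * ‖L.psi 0 (-k ^ 2)‖ ^ 2) * h3

end PolySLProblem

/-! ### Uniqueness of the coefficient -/

/-- If the entry `c̃ s - c s̃` of the transition matrix between two fundamental systems at one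
spectral parameter vanishes on `[0, π]`, then the coefficients agree. Indeed the derivative of this
entry identifies the two diagonal entries, whose sum is then constant; so both are `1`, and the
remaining entry is `σ' - σ` on the one hand and constant on the other. -/
theorem ae_eq_of_cross_eq_zero {σ σ' : ℝ → ℂ} {lam : ℂ} {c c₁ s s₁ c' c₁' s' s₁' : ℝ → ℂ}
    (hc : IsSLSolution σ lam c c₁) (hs : IsSLSolution σ lam s s₁)
    (hc' : IsSLSolution σ' lam c' c₁') (hs' : IsSLSolution σ' lam s' s₁')
    (hc0 : c 0 = 1) (hc₁0 : c₁ 0 = 0) (hs0 : s 0 = 0) (hs₁0 : s₁ 0 = 1)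
    (hc0' : c' 0 = 1) (hc₁0' : c₁' 0 = 0) (hs0' : s' 0 = 0) (hs₁0' : s₁' 0 = 1)
    (h : ∀ x ∈ Icc 0 π, c' x * s x - c x * s' x = 0) :
    ∀ᵐ x ∂volume.restrict (Ioo 0 π), σ x = σ' x := by
  have hac : ∀ {p q r t : ℝ → ℂ}, AbsolutelyContinuousOnInterval p 0 π →
      AbsolutelyContinuousOnInterval q 0 π → AbsolutelyContinuousOnInterval r 0 π →
      AbsolutelyContinuousOnInterval t 0 π →
      AbsolutelyContinuousOnInterval (fun x => p x * q x - r x * t x) 0 π :=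
    fun hp hq hr ht => (hp.fun_smul hq).fun_sub (hr.fun_smul ht)
  have hmem : ∀ᵐ x ∂volume.restrict (Ioo 0 π), x ∈ Ioo 0 π := ae_restrict_mem measurableSet_Ioo
  -- Differentiating the vanishing entry.
  have hdiag : ∀ᵐ x ∂volume.restrict (Ioo 0 π),
      c x * s₁' x - s x * c₁' x = s₁ x * c' x - c₁ x * s' x := by
    filter_upwards [hmem, hc.hasDerivAt, hs.hasDerivAt, hc'.hasDerivAt, hs'.hasDerivAt]
      with x hx dc ds dc' ds'
    have hd := (dc'.1.fun_mul ds.1).fun_sub (dc.1.fun_mul ds'.1)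
    have h0 : HasDerivAt (fun x => c' x * s x - c x * s' x) 0 x := by
      refine (hasDerivAt_const x (0 : ℂ)).congr_of_eventuallyEq ?_
      filter_upwards [Ioo_mem_nhds hx.1 hx.2] with t ht
      exact h t (Ioo_subset_Icc_self ht)
    have := hd.unique h0
    linear_combination -this + (σ x + σ' x) * h x (Ioo_subset_Icc_self hx)
  have hsum : ∀ x ∈ Icc 0 π,
      (c x * s₁' x - s x * c₁' x) + (s₁ x * c' x - c₁ x * s' x) = 2 := by
    intro x hx
    rw [eq_left_of_ac (y := fun x => (c x * s₁' x - s x * c₁' x) + (s₁ x * c' x - c₁ x * s' x))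
      ((hac hc.ac hs'.ac_quasi hs.ac hc'.ac_quasi).fun_add
        (hac hs.ac_quasi hc'.ac hc.ac_quasi hs'.ac)) ?_ hx]
    · rw [hc0, hs0, hs₁0, hc₁0, hc0', hs0', hs₁0', hc₁0']; norm_num
    · filter_upwards [hmem, hdiag, hc.hasDerivAt, hs.hasDerivAt, hc'.hasDerivAt, hs'.hasDerivAt]
        with x hx hdx dc ds dc' ds'
      refine (((dc.1.fun_mul ds'.2).fun_sub (ds.1.fun_mul dc'.2)).fun_add
        ((ds.2.fun_mul dc'.1).fun_sub (dc.2.fun_mul ds'.1))).congr_deriv ?_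
      linear_combination (σ x - σ' x) * hdx +
        (σ' x ^ 2 - σ x ^ 2) * h x (Ioo_subset_Icc_self hx)
  have hone : ∀ᵐ x ∂volume.restrict (Ioo 0 π), c x * s₁' x - s x * c₁' x = 1 := by
    filter_upwards [hmem, hdiag] with x hx hdx
    linear_combination (hsum x (Ioo_subset_Icc_self hx) + hdx) / 2
  have hone' : ∀ x ∈ Ioo 0 π, c x * s₁' x - s x * c₁' x = 1 := by
    have hcont := (hac hc.ac hs'.ac_quasi hs.ac hc'.ac_quasi).continuousOn
    rw [uIcc_of_le pi_pos.le] at hcont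
    exact Measure.eqOn_open_of_ae_eq hone isOpen_Ioo (hcont.mono Ioo_subset_Icc_self)
      continuousOn_const
  have hsub : ∀ᵐ x ∂volume.restrict (Ioo 0 π), c₁ x * s₁' x - s₁ x * c₁' x = σ' x - σ x := by
    filter_upwards [hmem, hc.hasDerivAt, hs.hasDerivAt, hc'.hasDerivAt, hs'.hasDerivAt]
      with x hx dc ds dc' ds'
    have h0 : HasDerivAt (fun x => c x * s₁' x - s x * c₁' x) 0 x := by
      refine (hasDerivAt_const x (1 : ℂ)).congr_of_eventuallyEq ?_
      filter_upwards [Ioo_mem_nhds hx.1 hx.2] with t ht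
      exact hone' t ht
    have := ((dc.1.fun_mul ds'.2).fun_sub (ds.1.fun_mul dc'.2)).unique h0
    linear_combination this + (σ' x - σ x) * hone' x hx -
      (σ' x ^ 2 + lam) * h x (Ioo_subset_Icc_self hx)
  have hzero : ∀ x ∈ Icc 0 π, c₁ x * s₁' x - s₁ x * c₁' x = 0 := by
    intro x hx
    rw [eq_left_of_ac (y := fun x => c₁ x * s₁' x - s₁ x * c₁' x)
      (hac hc.ac_quasi hs'.ac_quasi hs.ac_quasi hc'.ac_quasi) ?_ hx]
    · rw [hc₁0, hs₁0, hs₁0', hc₁0']; norm_num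
    · filter_upwards [hmem, hsub, hdiag, hc.hasDerivAt, hs.hasDerivAt, hc'.hasDerivAt,
        hs'.hasDerivAt] with x hx hsx hdx dc ds dc' ds'
      refine ((dc.2.fun_mul ds'.2).fun_sub (ds.2.fun_mul dc'.2)).congr_deriv ?_
      have h1 := hone' x hx
      linear_combination (-(σ x + σ' x)) * hsx - (σ x ^ 2 + lam) * h1 +
        (σ' x ^ 2 + lam) * (h1 - hdx)
  filter_upwards [hmem, hsub] with x hx hsx
  rw [hzero x (Ioo_subset_Icc_self hx)] at hsx
  exact (sub_eq_zero.mp hsx.symm).symm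

/-! ### Uniqueness of the boundary condition -/

theorem IsNormalizedPair.eq_of_mul_eq_mul {r₁ r₂ r₁' r₂' : ℂ[X]} (h : IsCoprime r₁ r₂)
    (h' : IsCoprime r₁' r₂') (hn : IsNormalizedPair r₁ r₂) (hn' : IsNormalizedPair r₁' r₂')
    (he : r₁ * r₂' = r₂ * r₁') : r₁ = r₁' ∧ r₂ = r₂' := by
  have a1 : Associated r₁ r₁' := associated_of_dvd_dvd
    (h.dvd_of_dvd_mul_left (Dvd.intro _ he))
    (h'.dvd_of_dvd_mul_right (Dvd.intro_left _ he.symm))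
  have a2 : Associated r₂ r₂' := associated_of_dvd_dvd
    (h.symm.dvd_of_dvd_mul_left (Dvd.intro _ he.symm))
    (h'.symm.dvd_of_dvd_mul_right (Dvd.intro_left _ he))
  have d1 := degree_eq_degree_of_associated a1
  have d2 := degree_eq_degree_of_associated a2
  rcases hn with ⟨hd, hl⟩ | ⟨hd, hl⟩ <;> rcases hn' with ⟨hd', hl'⟩ | ⟨hd', hl'⟩
  · have e : r₁ = r₁' := eq_of_monic_of_associated hl hl' a1
    have hne : r₁ ≠ 0 := Monic.ne_zero hl
    refine ⟨e, ?_⟩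
    rw [← e, mul_comm r₂] at he
    exact (mul_left_cancel₀ hne he).symm
  · rw [← d1, ← d2] at hd'
    exact absurd hd (not_le.mpr hd')
  · rw [← d1, ← d2] at hd'
    exact absurd hd (not_lt.mpr hd')
  · have e : r₂ = r₂' := eq_of_monic_of_associated hl hl' a2
    have hne : r₂ ≠ 0 := Monic.ne_zero hl
    refine ⟨?_, e⟩
    rw [← e, mul_comm r₁] at he
    exact mul_left_cancel₀ hne he

/-! ### Uniqueness from the Weyl function -/

namespace PolySLProblem

/-- `ψ` in the fundamental system normalized at `0`. -/
theorem psi_eq (L : PolySLProblem) (lam : ℂ) {x : ℝ} (hx : x ∈ Icc 0 π) :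
    L.psi x lam = L.psi 0 lam * (initialSol L.memLp 1 0 lam).1 x +
      L.psiQuasi 0 lam * (initialSol L.memLp 0 1 lam).1 x := by
  have h := (L.psi_spec lam).1.variation_of_constants
    (isSLSolution_initialSol L.memLp 1 0 lam) (isSLSolution_initialSol L.memLp 0 1 lam)
    (initialSol_fst_zero L.memLp 1 0 lam) (initialSol_snd_zero L.memLp 1 0 lam)
    (initialSol_fst_zero L.memLp 0 1 lam) (initialSol_snd_zero L.memLp 0 1 lam) hx
  simpa using h

/-- Equal Weyl functions mean that the functions `ψ` of the two problems have proportional Cauchy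
data at `0`, for `lam = -k²` with `Re k` large. -/
theorem exists_psi_mul_eq {L L' : PolySLProblem} (hp : L.p₁ ≠ 0) (hp₁ : L.p₁ = L'.p₁)
    (hp₂ : L.p₂ = L'.p₂)
    (hM : ∀ lam : ℂ, L.weylDenom lam ≠ 0 → L'.weylDenom lam ≠ 0 →
      L.weylFunction lam = L'.weylFunction lam) :
    ∃ R : ℝ, ∀ k : ℂ, R ≤ k.re →
      L.psi 0 (-k ^ 2) * L'.psiQuasi 0 (-k ^ 2) = L.psiQuasi 0 (-k ^ 2) * L'.psi 0 (-k ^ 2) := by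
  obtain ⟨R, _, _, h⟩ := L.exists_psi_bound hp
  obtain ⟨R', _, _, h'⟩ := L'.exists_psi_bound (hp₁ ▸ hp)
  obtain ⟨_, R'', _, h''⟩ := exists_bound_of_parity (q := 0) (Or.inl hp)
  refine ⟨max R (max R' R''), fun k hk => ?_⟩
  obtain ⟨-, hΔ, -⟩ := h k ((le_max_left _ _).trans hk)
  obtain ⟨-, hΔ', -⟩ := h' k ((le_max_left _ _).trans ((le_max_right _ _).trans hk))
  have hpk : L.p₁.eval (-k ^ 2) ≠ 0 := fun h0 => (h'' k (((le_max_right _ _).trans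
    ((le_max_right _ _).trans hk)).trans (Complex.re_le_norm k))).1 (by simp [h0])
  have he := neg_injective (hM _ hΔ hΔ')
  rw [div_eq_div_iff hΔ hΔ'] at he
  simp only [weylDenom, ← hp₁, ← hp₂] at he
  apply mul_left_cancel₀ hpk
  linear_combination he

/-- The off-diagonal entry of the transition matrix vanishes for every spectral parameter. -/
theorem cross_eq_zero {L L' : PolySLProblem} (hp : L.p₁ ≠ 0) (hp₁ : L.p₁ = L'.p₁)
    (hp₂ : L.p₂ = L'.p₂)
    (hM : ∀ lam : ℂ, L.weylDenom lam ≠ 0 → L'.weylDenom lam ≠ 0 →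
      L.weylFunction lam = L'.weylFunction lam) {x : ℝ} (hx : x ∈ Icc 0 π) (lam : ℂ) :
    (initialSol L'.memLp 1 0 lam).1 x * (initialSol L.memLp 0 1 lam).1 x -
      (initialSol L.memLp 1 0 lam).1 x * (initialSol L'.memLp 0 1 lam).1 x = 0 := by
  obtain ⟨R₀, h₀⟩ := exists_psi_mul_eq hp hp₁ hp₂ hM
  obtain ⟨R, C, hC0, h⟩ := L.exists_psi_bound hp
  obtain ⟨R', C', hC0', h'⟩ := L'.exists_psi_bound (hp₁ ▸ hp)
  set g := Real.exp (growthConst L.σ / 2) with hg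
  set g' := Real.exp (growthConst L'.σ / 2) with hg'
  refine eq_zero_of_decay_of_growth (f := fun lam =>
    (initialSol L'.memLp 1 0 lam).1 x * (initialSol L.memLp 0 1 lam).1 x -
      (initialSol L.memLp 1 0 lam).1 x * (initialSol L'.memLp 0 1 lam).1 x)
    (A := 2 * (g' * g)) (B := 2 * π) (K := C' * g + C * g') (R := max (max R R') (max R₀ 1))
    ?_ (fun k hkre hk => ?_) (fun k hk => ?_) lam
  · exact ((differentiable_initialSol L'.memLp 1 0 hx).mul
      (differentiable_initialSol L.memLp 0 1 hx)).sub
      ((differentiable_initialSol L.memLp 1 0 hx).mul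
      (differentiable_initialSol L'.memLp 0 1 hx))
  · have hexp : Real.exp (k.re * x) ≤ Real.exp (π * ‖k‖) := by
      apply Real.exp_le_exp.mpr
      rw [mul_comm π]
      exact mul_le_mul (Complex.re_le_norm k) hx.2 hx.1 (norm_nonneg _)
    have hc : ∀ M : PolySLProblem, ‖(initialSol M.memLp 1 0 (-k ^ 2)).1 x‖ ≤
        Real.exp (growthConst M.σ / 2) * Real.exp (π * ‖k‖) := fun M => by
      refine (norm_initialSol_le M.memLp 1 0 hk hkre hx).trans ?_
      rw [norm_one, norm_zero, zero_div, add_zero, one_mul]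
      gcongr
    have hs : ∀ M : PolySLProblem, ‖(initialSol M.memLp 0 1 (-k ^ 2)).1 x‖ ≤
        Real.exp (growthConst M.σ / 2) * Real.exp (π * ‖k‖) := fun M => by
      refine (norm_initialSol_le M.memLp 0 1 hk hkre hx).trans ?_
      rw [norm_one, norm_zero, zero_add, mul_assoc]
      refine (mul_le_of_le_one_left (by positivity) ((div_le_one (by linarith)).mpr hk)).trans ?_
      gcongr
    have e : Real.exp (2 * π * ‖k‖) = Real.exp (π * ‖k‖) * Real.exp (π * ‖k‖) := by
      rw [← Real.exp_add]; congr 1; ring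
    rw [e]
    refine (norm_sub_le _ _).trans ?_
    rw [norm_mul, norm_mul]
    calc _ ≤ (g' * Real.exp (π * ‖k‖)) * (g * Real.exp (π * ‖k‖)) +
          (g * Real.exp (π * ‖k‖)) * (g' * Real.exp (π * ‖k‖)) := by
          gcongr
          exacts [hc L', hs L, hc L, hs L']
      _ = _ := by ring
  · obtain ⟨n0, -, hb⟩ := h k ((le_max_left _ _).trans ((le_max_left _ _).trans hk))
    obtain ⟨n0', -, hb'⟩ := h' k ((le_max_right _ _).trans ((le_max_left _ _).trans hk))
    have hW := h₀ k ((le_max_left _ _).trans ((le_max_right _ _).trans hk))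
    have hk1 : 1 ≤ k.re := (le_max_right _ _).trans ((le_max_right _ _).trans hk)
    have hkn : 1 ≤ ‖k‖ := hk1.trans (Complex.re_le_norm k)
    have hs : ∀ M : PolySLProblem, ‖(initialSol M.memLp 0 1 (-k ^ 2)).1 x‖ ≤
        1 / ‖k‖ * Real.exp (growthConst M.σ / 2) * Real.exp (k.re * x) := fun M => by
      refine (norm_initialSol_le M.memLp 0 1 hkn (by linarith) hx).trans (le_of_eq ?_)
      rw [norm_one, norm_zero, zero_add]
    have e := L.psi_eq (-k ^ 2) hx
    have e' := L'.psi_eq (-k ^ 2) hx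
    have hsL := hs L
    have hsL' := hs L'
    have b := hb x hx
    have b' := hb' x hx
    rw [← hg] at hsL
    rw [← hg'] at hsL'
    generalize (initialSol L.memLp 1 0 (-k ^ 2)).1 x = c at *
    generalize (initialSol L.memLp 0 1 (-k ^ 2)).1 x = s at *
    generalize (initialSol L'.memLp 1 0 (-k ^ 2)).1 x = c' at *
    generalize (initialSol L'.memLp 0 1 (-k ^ 2)).1 x = s' at *
    -- Replacing `c`, `c'` by the two Weyl solutions does not change the entry.
    have key : c' * s - c * s' = L'.psi x (-k ^ 2) / L'.psi 0 (-k ^ 2) * s -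
        L.psi x (-k ^ 2) / L.psi 0 (-k ^ 2) * s' := by
      rw [e, e']
      field_simp
      linear_combination (-(s * s')) * hW
    have w : ‖L.psi x (-k ^ 2) / L.psi 0 (-k ^ 2)‖ ≤ C * Real.exp (-(k.re * x)) := by
      rw [norm_div, div_le_iff₀ (norm_pos_iff.mpr n0)]; exact b
    have w' : ‖L'.psi x (-k ^ 2) / L'.psi 0 (-k ^ 2)‖ ≤ C' * Real.exp (-(k.re * x)) := by
      rw [norm_div, div_le_iff₀ (norm_pos_iff.mpr n0')]; exact b'
    have hexp : Real.exp (-(k.re * x)) * Real.exp (k.re * x) = 1 := by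
      rw [← Real.exp_add, neg_add_cancel, Real.exp_zero]
    rw [key]
    refine (norm_sub_le _ _).trans ?_
    rw [norm_mul, norm_mul]
    calc _ ≤ C' * Real.exp (-(k.re * x)) * (1 / ‖k‖ * g * Real.exp (k.re * x)) +
          C * Real.exp (-(k.re * x)) * (1 / ‖k‖ * g' * Real.exp (k.re * x)) := by gcongr
      _ = (C' * g + C * g') / ‖k‖ := by
          linear_combination ((C' * g + C * g') / ‖k‖) * hexp

end PolySLProblem

theorem mainTheorem2 (L L' : PolySLProblem)
    (hr : IsNormalizedPair L.r₁ L.r₂) (hr' : IsNormalizedPair L'.r₁ L'.r₂)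
    (hp : L.p₁ ≠ 0) (hp₁ : L.p₁ = L'.p₁) (hp₂ : L.p₂ = L'.p₂)
    (hM : ∀ lam : ℂ, L.weylDenom lam ≠ 0 → L'.weylDenom lam ≠ 0 →
      L.weylFunction lam = L'.weylFunction lam) :
    (∀ᵐ x ∂volume.restrict (Ioo 0 π), L.σ x = L'.σ x) ∧ L.r₁ = L'.r₁ ∧ L.r₂ = L'.r₂ := by
  have hσ : ∀ᵐ x ∂volume.restrict (Ioo 0 π), L.σ x = L'.σ x :=
    ae_eq_of_cross_eq_zero
      (isSLSolution_initialSol L.memLp 1 0 0) (isSLSolution_initialSol L.memLp 0 1 0)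
      (isSLSolution_initialSol L'.memLp 1 0 0) (isSLSolution_initialSol L'.memLp 0 1 0)
      (initialSol_fst_zero _ _ _ _) (initialSol_snd_zero _ _ _ _)
      (initialSol_fst_zero _ _ _ _) (initialSol_snd_zero _ _ _ _)
      (initialSol_fst_zero _ _ _ _) (initialSol_snd_zero _ _ _ _)
      (initialSol_fst_zero _ _ _ _) (initialSol_snd_zero _ _ _ _)
      (fun x hx => PolySLProblem.cross_eq_zero hp hp₁ hp₂ hM hx 0)
  refine ⟨hσ, IsNormalizedPair.eq_of_mul_eq_mul L.coprime_r L'.coprime_r hr hr' ?_⟩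
  -- With equal coefficients, the Wronskian of the two functions `ψ` is constant on `[0, π]`.
  obtain ⟨R, hR⟩ := PolySLProblem.exists_psi_mul_eq hp hp₁ hp₂ hM
  refine Polynomial.eq_of_infinite_eval_eq _ _ ?_
  refine Set.Infinite.mono (s := (fun t : ℝ => -(t : ℂ) ^ 2) '' Ici (max R 0)) ?_ ?_
  · rintro _ ⟨t, ht, rfl⟩
    obtain ⟨hψ, h1, h2⟩ := L.psi_spec (-(t : ℂ) ^ 2)
    obtain ⟨hψ', h1', h2'⟩ := L'.psi_spec (-(t : ℂ) ^ 2)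
    have hW := (hψ.congr_coeff hσ).wronskian_eq hψ' (right_mem_Icc.mpr pi_pos.le)
    rw [h1, h2, h1', h2', hR t (by simpa using (le_max_left _ _).trans ht)] at hW
    simp only [sub_self, zero_mul, add_zero] at hW
    simp only [mem_ofPred_eq, eval_mul]
    linear_combination -hW
  · refine (Set.Ici_infinite _).image fun a ha b hb hab => ?_
    have ha0 : 0 ≤ a := (le_max_right _ _).trans ha
    have hb0 : 0 ≤ b := (le_max_right _ _).trans hb
    have : (a : ℂ) ^ 2 = (b : ℂ) ^ 2 := neg_injective hab
    exact (pow_left_inj₀ ha0 hb0 two_ne_zero).mp (by exact_mod_cast this)
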